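/- Conventions. All decoders are non-adaptive. A code $C:\{0,1\}^n\to\{0,1\}^m$ is a $(q,\delta,\varepsilon)$-LDC if for every $i$ there is a classical randomized decoder which reads at most $q$ bits of a word $y$ and outputs $x_i$ with probability at least $1/2+\varepsilon$ whenever $d(C(x),y)\le\delta m$ (Hamming distance); it is of XOR type if the decoder makes exactly $q$ queries and outputs the XOR of the $q$ queried bits. It is a $(q,\delta,\varepsilon)$-LQDC if the same holds for a quantum decoder that prepares a state of a workspace and $q$ query registers, makes $q$ parallel queries $|c\rangle|j\rangle\mapsto(-1)^{c\cdot y_j}|c\rangle|j\rangle$ in superposition, and applies a two-outcome POVM. A $k$-server PIR scheme is one-round, with $t$-bit queries and $a$-bit answers; from its $k$ answers the user must obtain $x_i$, for every database $x\in\{0,1\}^n$ and every $i$, with probability at least $1/2+\varepsilon$ (perfect recovery: $\varepsilon=1/2$), and the distribution of the query to each single server must not depend on $i$. In a quantum PIR scheme the user prepares a state of a private workspace and of $k$ registers of $t$ qubits and sends one register to each server, each server applies a quantum operation depending on $x$ and returns $a$ qubits, and the user measures; the reduced state that each server receives must not depend on $i$. The communication is $k(t+a)$ (qu)bits. Theorem.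 1. (XOR halving for PIR) If there is a classical $2k$-server PIR scheme with $t$-bit queries, 1-bit answers and recovery probability $1/2+\varepsilon$ whose user outputs the XOR of the $2k$ answers, then there is a quantum $k$-server PIR scheme with $(t+1)$-qubit queries, $(t+1)$-qubit answers and recovery probability $1/2+\varepsilon$. 2. (XOR halving for codes) Every $(2q,\delta,\varepsilon)$-LDC of XOR type is a $(q,\delta,\varepsilon)$-LQDC. 3. There are quantum PIR schemes with perfect recovery for $n$-bit databases, $n\ge1$, with $2$ servers and $O(n^{3/10})$ qubits of communication, with $3$ servers and $O(n^{1/7})$ qubits, and with $4$ servers and $O(n^{1/11})$ qubits. 4. For $(q,\alpha)\in\{(2,3/10),(3,1/7),(4,1/11)\}$ and every constant $\varepsilon\in(0,1/2)$ there are constants $\delta>0$ and $c$ such that for every $n\ge1$ there is a $(q,\delta,\varepsilon)$-LQDC $C:\{0,1\}^n\to\{0,1\}^m$ with $m\le 2^{c\,n^{\alpha}}$. 5. (Classical bounds for comparison) There are classical 2-server PIR schemes with perfect recovery and $O(n^{1/3})$ bits of communication. The length of 2-query LDCs is $2^{\Theta(n)}$: for all $\delta,\varepsilon>0$ there is $c>0$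 such that every $(2,\delta,\varepsilon)$-LDC $C:\{0,1\}^n\to\{0,1\}^m$ with $n\ge1$ has $m\ge2^{cn-1}$; and for all $n$ and $\delta\ge0$ there is a $(2,\delta,1/2-2\delta)$-LDC $C:\{0,1\}^n\to\{0,1\}^{2^n}$. -/

import Mathlib

open scoped Matrix ComplexOrder

noncomputable section

/-! ## Classical notions -/

/-- Bit strings of length `n`. -/
abbrev Bits (n : ℕ) : Type := Fin n → Bool

/-- The exclusive or of a family of bits. -/
def xorAll {k : ℕ} (b : Bits k) : Bool :=
  decide (Odd (Finset.univ.filter (fun j => b j = true)).card)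

/-- The probability of the event `s` under the distribution `p`, as a real number. -/
def prob {Ω : Type} (p : PMF Ω) (s : Set Ω) : ℝ := (p.toOuterMeasure s).toReal

/-- `C` is a `(q, δ, ε)`-locally decodable code. The randomness of the non-adaptive decoder on
input `i` determines a set `J` of at most `q` positions and an output function `f` of the
(possibly corrupted) codeword that depends only on the bits at the positions in `J`. -/
def IsLDC {n m : ℕ} (q : ℕ) (δ ε : ℝ) (C : Bits n → Bits m) : Prop :=
  ∀ i : Fin n, ∃ A : PMF (Finset (Fin m) × (Bits m → Bool)),
    (∀ ω ∈ A.support, ω.1.card ≤ q ∧ DependsOn ω.2 (ω.1 : Set (Fin m))) ∧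
    ∀ (x : Bits n) (y : Bits m), (hammingDist (C x) y : ℝ) ≤ δ * m →
      1 / 2 + ε ≤ prob A {ω | ω.2 y = x i}

/-- `C` is a `(q, δ, ε)`-locally decodable code whose decoder outputs the exclusive or of the
`q` bits that it queries (non-adaptively, at random positions). -/
def IsXorLDC {n m : ℕ} (q : ℕ) (δ ε : ℝ) (C : Bits n → Bits m) : Prop :=
  ∀ i : Fin n, ∃ A : PMF (Fin q → Fin m),
    ∀ (x : Bits n) (y : Bits m), (hammingDist (C x) y : ℝ) ≤ δ * m →
      1 / 2 + ε ≤ prob A {J | xorAll (fun l => y (J l)) = x i}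

/-- One-round classical `k`-server private information retrieval schemes for `n`-bit databases,
with `t`-bit queries, `a`-bit answers, recovery probability `1/2 + ε` and perfect privacy.
The user's randomness determines the queries and the output as a function of the answers. -/
structure ClassicalPIR (k n t a : ℕ) (ε : ℝ) where
  user : Fin n → PMF ((Fin k → Bits t) × ((Fin k → Bits a) → Bool))
  server : Fin k → Bits n → Bits t → Bits a
  recovers : ∀ (x : Bits n) (i : Fin n),
    1 / 2 + ε ≤ prob (user i) {ω | ω.2 (fun j => server j x (ω.1 j)) = x i}
  secret : ∀ (j : Fin k) (i i' : Fin n),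
    (user i).map (fun ω => ω.1 j) = (user i').map (fun ω => ω.1 j)

/-- A scheme with one-bit answers whose user outputs the exclusive or of the answers. -/
def ClassicalPIR.IsXor {k n t : ℕ} {ε : ℝ} (S : ClassicalPIR k n t 1 ε) : Prop :=
  ∀ (i : Fin n), ∀ ω ∈ (S.user i).support, ∀ ans : Fin k → Bits 1,
    ω.2 ans = xorAll (fun j => ans j 0)

/-! ## Quantum notions

A vector of amplitudes over a finite set `B` of basis states is a function `B → ℂ`; an
`ℓ`-qubit register has the basis states `Bits ℓ`. -/

/-- `ψ` is a unit vector, i.e. a pure state. -/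
def IsState {B : Type} [Fintype B] (ψ : B → ℂ) : Prop := ∑ b, ‖ψ b‖ ^ 2 = 1

/-- `D` and `1 - D` form a two-outcome POVM; `D` belongs to the outcome `true`. -/
def IsPOVM {B : Type} [Fintype B] [DecidableEq B] (D : Matrix B B ℂ) : Prop :=
  D.PosSemidef ∧ (1 - D).PosSemidef

/-- The probability `⟨v, E v⟩` of the outcome `b` of the POVM given by `D`, for the (possibly
subnormalized) vector `v`. -/
def outcomeProb {B : Type} [Fintype B] [DecidableEq B]
    (D : Matrix B B ℂ) (b : Bool) (v : B → ℂ) : ℝ :=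
  (star v ⬝ᵥ ((if b then D else 1 - D) *ᵥ v)).re

/-- One query to `y`, on the basis state `|c⟩|j⟩`, multiplies it by `(-1) ^ (c · y_j)`. -/
def queryPhase {m : ℕ} (y : Bits m) (cj : Bool × Fin m) : ℂ :=
  if (cj.1 && y cj.2) = true then -1 else 1

/-- The effect of `q` parallel (non-adaptive) queries to `y`, in superposition, on a state of a
`w`-dimensional workspace and `q` query registers. -/
def applyQueries {m w q : ℕ} (y : Bits m) (ψ : Fin w × (Fin q → Bool × Fin m) → ℂ) :
    Fin w × (Fin q → Bool × Fin m) → ℂ :=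
  fun b => (∏ l, queryPhase y (b.2 l)) * ψ b

/-- `C` is a `(q, δ, ε)`-locally quantum-decodable code: on input `i` the decoder prepares a
state, makes `q` non-adaptive quantum queries to the (possibly corrupted) codeword, and
measures. A query with control bit `0` does nothing, so this is "at most `q` queries". -/
def IsLQDC {n m : ℕ} (q : ℕ) (δ ε : ℝ) (C : Bits n → Bits m) : Prop :=
  ∀ i : Fin n, ∃ (w : ℕ) (ψ : Fin w × (Fin q → Bool × Fin m) → ℂ)
    (D : Matrix (Fin w × (Fin q → Bool × Fin m)) (Fin w × (Fin q → Bool × Fin m)) ℂ),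
    IsState ψ ∧ IsPOVM D ∧
    ∀ (x : Bits n) (y : Bits m), (hammingDist (C x) y : ℝ) ≤ δ * m →
      1 / 2 + ε ≤ outcomeProb D (x i) (applyQueries y ψ)

/-- The reduced density matrix on the `j`-th message register of a pure state of a workspace
and `k` message registers of `t` qubits. -/
def reducedState {k t w : ℕ} (ψ : Fin w × (Fin k → Bits t) → ℂ) (j : Fin k) :
    Matrix (Bits t) (Bits t) ℂ :=
  Matrix.of fun b b' =>
    ∑ u : Fin w, ∑ Q : Fin k → Bits t,
      if Q j = b then ψ (u, Q) * star (ψ (u, Function.update Q j b')) else 0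

/-- The tensor product of the identity on the workspace and of matrices `K j` on the message
registers, applied to `ψ`. -/
def applyLocal {k t a w : ℕ} (K : Fin k → Matrix (Bits a) (Bits t) ℂ)
    (ψ : Fin w × (Fin k → Bits t) → ℂ) : Fin w × (Fin k → Bits a) → ℂ :=
  fun b => ∑ Q : Fin k → Bits t, (∏ j, K j (b.2 j) (Q j)) * ψ (b.1, Q)

/-- One-round quantum `k`-server private information retrieval schemes for `n`-bit databases,
with `t`-qubit queries, `a`-qubit answers, recovery probability `1/2 + ε` and perfect privacy.

On input `i` the user prepares a state of a private workspace and `k` registers of `t` qubits,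
and sends the `j`-th register to server `j`. Server `j`, who holds the database `x`, applies a
quantum operation (with Kraus operators `server j x e`) and returns `a` qubits. The user measures
the workspace and all answers. The state that a server receives does not depend on `i`. -/
structure QuantumPIR (k n t a : ℕ) (ε : ℝ) where
  w : ℕ
  query : Fin n → Fin w × (Fin k → Bits t) → ℂ
  query_state : ∀ i, IsState (query i)
  r : ℕ
  server : Fin k → Bits n → Fin r → Matrix (Bits a) (Bits t) ℂ
  server_trace : ∀ j x, ∑ e, (server j x e)ᴴ * server j x e = 1
  measurement : Fin n →
    Matrix (Fin w × (Fin k → Bits a)) (Fin w × (Fin k → Bits a)) ℂ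
  measurement_povm : ∀ i, IsPOVM (measurement i)
  recovers : ∀ (x : Bits n) (i : Fin n),
    1 / 2 + ε ≤ ∑ e : Fin k → Fin r,
      outcomeProb (measurement i) (x i) (applyLocal (fun j => server j x (e j)) (query i))
  secret : ∀ (j : Fin k) (i i' : Fin n),
    reducedState (query i) j = reducedState (query i') j

/-! ## Asymptotic bounds -/

/-- There are classical `k`-server PIR schemes with perfect recovery and perfect privacy whose
total communication, in bits, is `O(n ^ α)`. -/
def HasClassicalPIR (k : ℕ) (α : ℝ) : Prop :=
  ∃ c : ℝ, ∀ n : ℕ, 1 ≤ n → ∃ t a : ℕ,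
    Nonempty (ClassicalPIR k n t a (1 / 2)) ∧ ((k * (t + a) : ℕ) : ℝ) ≤ c * (n : ℝ) ^ α

/-- There are quantum `k`-server PIR schemes with perfect recovery and perfect privacy whose
total communication, in qubits, is `O(n ^ α)`. -/
def HasQuantumPIR (k : ℕ) (α : ℝ) : Prop :=
  ∃ c : ℝ, ∀ n : ℕ, 1 ≤ n → ∃ t a : ℕ,
    Nonempty (QuantumPIR k n t a (1 / 2)) ∧ ((k * (t + a) : ℕ) : ℝ) ≤ c * (n : ℝ) ^ α

/-- For every constant advantage `ε < 1/2` and some constant noise rate `δ > 0`, there are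
`(q, δ, ε)`-locally quantum-decodable codes of length `2 ^ O(n ^ α)`. -/
def HasLQDC (q : ℕ) (α : ℝ) : Prop :=
  ∀ ε : ℝ, 0 < ε → ε < 1 / 2 → ∃ δ : ℝ, 0 < δ ∧ ∃ c : ℝ, ∀ n : ℕ, 1 ≤ n →
    ∃ (m : ℕ) (C : Bits n → Bits m),
      IsLQDC q δ ε C ∧ (m : ℝ) ≤ (2 : ℝ) ^ (c * (n : ℝ) ^ α)

end

/-!
The proof rests on four ideas.

*Halving.* A decoder that takes the exclusive or of `2q` classical answers is simulated by `q`
quantum queries: the answers are grouped into pairs, each query register holds a uniform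
superposition of the two members of its pair, and the workspace records the randomness and which
member was chosen. After the answers have been written into the phase, exchanging the members of
all pairs multiplies every amplitude by the sign of the exclusive or (`prod_bitSign_not`), so that
measuring the sign of this involution reveals it with certainty (`outcomeProb_flipMeasurement`).
Since the workspace is correlated with the messages, each message register is in a classical
mixture (`reducedState_correlated`), whence privacy.

*Matching families.* For primes `p ≠ q` and `w = p ^ a q ^ b - 1`, the functions from `w` points to
`s` points are encoded by the sets of `(p ^ a - 1)`-subsets, respectively `(q ^ b - 1)`-subsets, of
their graphs. By Lucas' theorem all intersections have sizes `0` or `1` modulo `p`, respectively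
`q`, and both remainders are `1` only for equal functions (`exists_matchingFamily`). There are `s ^
w` sets over a ground set of size `O(s ^ d)` with `d` the larger of the two exponents, and suitable
prime powers give `d / w ≤ 1 / 11`. With `p = 2` and `q = 3` such a family yields a perfect
two-server scheme: at a point with coordinates `±1`, the servers evaluate modulo `3` the monomials
given by the first family, summed with the incidence vectors of the second family as coefficients,
and in the combination of the answers every term but the wanted one is killed by one of its two
factors (`sum_matchingAnswer_sub`). A classical scheme is in particular a quantum one
(`ClassicalPIR.toQuantum`), and servers may be added, so this gives all the schemes. With `p = 3`,
`q = 5` and the field of `16` elements, the same effect is achieved by a sum over four points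
(`sum_matchingPoly_scaleOn`), which gives codes with four queries of the exclusive-or type; by
halving these are decodable with two quantum queries.

*The lower bound.* Erasing the positions that a decoder queries too often, its expected output
becomes a quadratic form in the signs of the codeword, with small row sums, that is correlated with
one bit of the message (`IsLDC.exists_form`). The moments of the signed sum of the `n` forms are
compared with those of a sum of `n` random signs (`norm_sum_signed_pow_le`): after averaging over
the signs only words with even multiplicities remain, and each is a product of contractions. A
moment of order proportional to `n` then bounds the dimension from below by an exponential
(`pow_le_of_correlated_forms`).

*The Hadamard code* is decoded from two uniformly distributed positions; the union bound for such
decoders is `isXorLDC_of_injective`.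
-/

/-! ### Signs of bits and finite probabilities -/

/-- The sign `(-1) ^ b` of a bit, in any ring. -/
def bitSign (R : Type*) [Ring R] (b : Bool) : R := if b then -1 else 1

@[simp] lemma bitSign_true (R : Type*) [Ring R] : bitSign R true = -1 := rfl
@[simp] lemma bitSign_false (R : Type*) [Ring R] : bitSign R false = 1 := rfl

lemma bitSign_mul_self (R : Type*) [Ring R] (b : Bool) : bitSign R b * bitSign R b = 1 := by
  cases b <;> simp

lemma bitSign_not (R : Type*) [Ring R] (b : Bool) : bitSign R (!b) = -bitSign R b := by
  cases b <;> simp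

lemma bitSign_xorAll (R : Type*) [CommRing R] {k : ℕ} (b : Bits k) :
    bitSign R (xorAll b) = ∏ j, bitSign R (b j) := by
  simp only [bitSign, xorAll, decide_eq_true_eq]
  rw [Finset.prod_ite]
  simp only [Finset.prod_const]
  split_ifs with h
  · simp [h.neg_one_pow]
  · simp [(Nat.not_odd_iff_even.mp h).neg_one_pow]

lemma bitSign_real_injective : Function.Injective (bitSign ℝ) := by
  intro a b h
  cases a <;> cases b <;> simp at h ⊢ <;> norm_num at h

lemma prob_eq_sum {Ω : Type} [Fintype Ω] (p : PMF Ω) (s : Set Ω) :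
    prob p s = ∑ ω, s.indicator (fun ω => (p ω).toReal) ω := by
  unfold prob
  rw [PMF.toOuterMeasure_apply_fintype, ENNReal.toReal_sum]
  · refine Finset.sum_congr rfl fun ω _ => ?_
    by_cases h : ω ∈ s <;> simp [h]
  · intro ω _
    by_cases h : ω ∈ s <;> simp [h, p.apply_ne_top]

lemma prob_setOf_eq_sum {Ω : Type} [Fintype Ω] (p : PMF Ω) (P : Ω → Prop) [DecidablePred P] :
    prob p {ω | P ω} = ∑ ω, if P ω then (p ω).toReal else 0 := by
  rw [prob_eq_sum]
  refine Finset.sum_congr rfl fun ω _ => ?_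
  by_cases h : P ω <;> simp [h]

lemma prob_univ {Ω : Type} (p : PMF Ω) : prob p Set.univ = 1 := by
  unfold prob
  rw [(PMF.toOuterMeasure_apply_eq_one_iff p _).mpr (Set.subset_univ _)]
  simp

lemma sum_toReal_eq_one {Ω : Type} [Fintype Ω] (p : PMF Ω) : ∑ ω, (p ω).toReal = 1 := by
  rw [← prob_univ p, prob_eq_sum]
  simp

lemma prob_map {Ω Ω' : Type} (p : PMF Ω) (f : Ω → Ω') (s : Set Ω') :
    prob (p.map f) s = prob p (f ⁻¹' s) := by
  unfold prob
  rw [PMF.toOuterMeasure_map_apply]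

lemma prob_congr_support {Ω : Type} (p : PMF Ω) {s t : Set Ω}
    (h : ∀ ω ∈ p.support, ω ∈ s ↔ ω ∈ t) : prob p s = prob p t := by
  unfold prob
  rw [PMF.toOuterMeasure_apply_eq_of_inter_support_eq]
  ext ω
  simp only [Set.mem_inter_iff]
  exact ⟨fun ⟨a, b⟩ => ⟨(h ω b).1 a, b⟩, fun ⟨a, b⟩ => ⟨(h ω b).2 a, b⟩⟩

/-! ### Measuring the symmetry of a correlated state -/

/-- The vector with amplitude `g u` on `|u⟩|e u⟩`: the workspace `u` determines the message. -/
def correlated {U M : Type} [DecidableEq M] (e : U → M) (g : U → ℂ) : U × M → ℂ :=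
  fun b => if b.2 = e b.1 then g b.1 else 0

lemma sum_correlated {U M : Type} [Fintype U] [Fintype M] {β : Type*} [AddCommMonoid β]
    (e : U → M) (F : U × M → β) (hF : ∀ u c, c ≠ e u → F (u, c) = 0) :
    ∑ b, F b = ∑ u, F (u, e u) := by
  rw [Fintype.sum_prod_type]
  refine Finset.sum_congr rfl fun u _ => ?_
  exact Finset.sum_eq_single (e u) (fun c _ hc => hF u c hc) (by simp)

lemma isState_correlated {U M : Type} [Fintype U] [Fintype M] [DecidableEq M]
    (e : U → M) (g : U → ℂ) (hg : ∑ u, ‖g u‖ ^ 2 = 1) : IsState (correlated e g) := by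
  unfold IsState
  rw [sum_correlated e _ (fun u c hc => by simp [correlated, hc])]
  simpa [correlated] using hg

/-- The permutation of the basis that applies `τ` to the support of a correlated state and fixes
all other basis states. -/
def flipPerm {U M : Type} [DecidableEq M] (e : U → M) (τ : U → U) (b : U × M) : U × M :=
  if b.2 = e b.1 then (τ b.1, e (τ b.1)) else b

lemma flipPerm_involutive {U M : Type} [DecidableEq M] (e : U → M) {τ : U → U}
    (hτ : Function.Involutive τ) : Function.Involutive (flipPerm e τ) := by
  rintro ⟨u, c⟩
  by_cases h : c = e u
  · simp [flipPerm, h, hτ u]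
  · simp [flipPerm, h]

/-- The measurement `{(1 - P) / 2, (1 + P) / 2}` of the sign of the involution
`P : |u⟩|e u⟩ ↦ |τ u⟩|e (τ u)⟩`. -/
noncomputable def flipMeasurement {U M : Type} [DecidableEq U] [DecidableEq M]
    (e : U → M) (τ : U → U) : Matrix (U × M) (U × M) ℂ :=
  (1 / 2 : ℂ) • (1 - Matrix.of fun b b' => if flipPerm e τ b = b' then 1 else 0)

lemma posSemidef_of_idempotent {B : Type} [Fintype B] {D : Matrix B B ℂ}
    (h₁ : Dᴴ = D) (h₂ : D * D = D) : D.PosSemidef := by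
  have := Matrix.posSemidef_conjTranspose_mul_self D
  rwa [h₁, h₂] at this

lemma isPOVM_of_idempotent {B : Type} [Fintype B] [DecidableEq B] {D : Matrix B B ℂ}
    (h₁ : Dᴴ = D) (h₂ : D * D = D) : IsPOVM D := by
  refine ⟨posSemidef_of_idempotent h₁ h₂, posSemidef_of_idempotent ?_ ?_⟩
  · simp [h₁]
  · simp only [mul_sub, sub_mul, mul_one, one_mul, h₂, sub_self, sub_zero]

lemma isPOVM_flipMeasurement {U M : Type} [Fintype U] [DecidableEq U] [Fintype M] [DecidableEq M]
    (e : U → M) {τ : U → U} (hτ : Function.Involutive τ) : IsPOVM (flipMeasurement e τ) := by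
  set P : Matrix (U × M) (U × M) ℂ := Matrix.of fun b b' => if flipPerm e τ b = b' then 1 else 0
    with hP
  have hinv := flipPerm_involutive e hτ
  have h1 : Pᴴ = P := by
    ext b b'
    have : flipPerm e τ b' = b ↔ flipPerm e τ b = b' :=
      ⟨fun h => by rw [← h, hinv], fun h => by rw [← h, hinv]⟩
    simp only [hP, Matrix.conjTranspose_apply, Matrix.of_apply, this]
    split_ifs <;> simp
  have h2 : P * P = 1 := by
    ext b b'
    rw [Matrix.mul_apply, Finset.sum_eq_single (flipPerm e τ b)]
    · simp [hP, hinv b, Matrix.one_apply]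
    · intro c _ hc
      simp [hP, hc.symm]
    · simp
  have hD : flipMeasurement e τ = (1 / 2 : ℂ) • (1 - P) := rfl
  apply isPOVM_of_idempotent
  · rw [hD]
    simp [h1]
  · rw [hD]
    have h3 : (1 - P) * (1 - P) = (2 : ℂ) • (1 - P) := by
      rw [mul_sub, sub_mul, sub_mul, h2, two_smul]
      simp only [mul_one, one_mul]
      abel
    rw [Matrix.smul_mul, Matrix.mul_smul, h3, smul_smul, smul_smul]
    norm_num

/-- If `τ` multiplies the amplitudes by the sign of the bit `out u`, then the measurement of that
sign reveals the bit with certainty. -/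
lemma outcomeProb_flipMeasurement {U M : Type} [Fintype U] [DecidableEq U] [Fintype M]
    [DecidableEq M] (e : U → M) (τ : U → U) (g : U → ℂ) (out : U → Bool)
    (hg : ∀ u, g (τ u) = bitSign ℂ (out u) * g u) (x : Bool) :
    outcomeProb (flipMeasurement e τ) x (correlated e g) =
      ∑ u, if out u = x then ‖g u‖ ^ 2 else 0 := by
  have hmul : ∀ v : U × M → ℂ, ∀ b, ((if x then flipMeasurement e τ
      else 1 - flipMeasurement e τ) *ᵥ v) b =
        (1 / 2) * (v b + bitSign ℂ x * v (flipPerm e τ b)) := by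
    intro v b
    have h0 : (Matrix.of (fun b b' => if flipPerm e τ b = b' then (1 : ℂ) else 0) *ᵥ v) b
        = v (flipPerm e τ b) := by
      simp [Matrix.mulVec, dotProduct]
    cases x
    · simp only [Bool.false_eq_true, if_false, flipMeasurement, Matrix.sub_mulVec,
        Matrix.smul_mulVec, Matrix.one_mulVec, Pi.sub_apply, Pi.smul_apply, h0, bitSign_false,
        smul_eq_mul]
      ring
    · simp only [if_true, flipMeasurement, Matrix.sub_mulVec,
        Matrix.smul_mulVec, Matrix.one_mulVec, Pi.sub_apply, Pi.smul_apply, h0, bitSign_true,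
        smul_eq_mul]
      ring
  unfold outcomeProb
  rw [dotProduct, sum_correlated e _ (fun u c hc => by simp [correlated, hc]), Complex.re_sum]
  refine Finset.sum_congr rfl fun u _ => ?_
  rw [hmul]
  have h1 : correlated e g (flipPerm e τ (u, e u)) = bitSign ℂ (out u) * g u := by
    simp [correlated, flipPerm, hg]
  have h2 : correlated e g (u, e u) = g u := by simp [correlated]
  rw [h1, Pi.star_apply, h2]
  have h3 : star (g u) * (1 / 2 * (g u + bitSign ℂ x * (bitSign ℂ (out u) * g u))) =
      ((if out u = x then ‖g u‖ ^ 2 else 0 : ℝ) : ℂ) := by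
    have : (starRingEnd ℂ) (g u) * g u = (‖g u‖ : ℂ) ^ 2 := Complex.conj_mul' _
    cases x <;> cases out u <;> simp <;> linear_combination this
  rw [h3, Complex.ofReal_re]

lemma reducedState_correlated {k t w : ℕ} (e : Fin w → Fin k → Bits t) (g : Fin w → ℂ)
    (j : Fin k) : reducedState (correlated e g) j =
      Matrix.diagonal fun c => ((∑ u, if e u j = c then ‖g u‖ ^ 2 else 0 : ℝ) : ℂ) := by
  ext c c'
  have h0 : reducedState (correlated e g) j c c' =
      ∑ u, if e u j = c ∧ c = c' then ((‖g u‖ ^ 2 : ℝ) : ℂ) else 0 := by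
    simp only [reducedState, Matrix.of_apply]
    refine Finset.sum_congr rfl fun u _ => ?_
    rw [Finset.sum_eq_single (e u)]
    · by_cases h : e u j = c
      · by_cases h' : c = c'
        · subst h' h
          simp [correlated, Complex.mul_conj, Complex.normSq_eq_norm_sq]
        · have : Function.update (e u) j c' ≠ e u := by
            intro h2
            apply h'
            rw [← h, ← congrFun h2 j]
            simp
          simp [correlated, h', this]
      · simp [h]
    · intro Q _ hQ
      simp [correlated, hQ]
    · simp
  rw [h0, Matrix.diagonal_apply]
  by_cases h : c = c'
  · subst h
    simp only [and_true, if_true]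
    push_cast
    refine Finset.sum_congr rfl fun u _ => ?_
    split_ifs <;> simp
  · simp [h]

/-! ### Halving the number of classical queries -/

/-- The `2k` classical queries are grouped into `k` pairs; `pairIndex b l` is the member `b` of
the pair `l`. -/
def pairIndex {k : ℕ} (b : Bool) (l : Fin k) : Fin (2 * k) :=
  finProdFinEquiv (finTwoEquiv.symm b, l)

lemma prod_pairIndex {k : ℕ} {R : Type*} [CommMonoid R] (F : Fin (2 * k) → R) :
    ∏ j, F j = ∏ l : Fin k, F (pairIndex false l) * F (pairIndex true l) := by
  rw [← finProdFinEquiv.prod_comp, Fintype.prod_prod_type, Finset.prod_mul_distrib,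
    Fin.prod_univ_two]
  rfl

/-- Exchanging the members of every pair multiplies the phase by the sign of the exclusive or of
all `2k` bits. -/
lemma prod_bitSign_not {k : ℕ} (R : Type*) [CommRing R] (F : Fin (2 * k) → Bool)
    (b : Fin k → Bool) :
    ∏ l, bitSign R (F (pairIndex (!b l) l)) =
      bitSign R (xorAll F) * ∏ l, bitSign R (F (pairIndex (b l) l)) := by
  rw [bitSign_xorAll, prod_pairIndex, ← Finset.prod_mul_distrib]
  refine Finset.prod_congr rfl fun l _ => ?_
  have h0 := bitSign_mul_self R (F (pairIndex false l))
  have h1 := bitSign_mul_self R (F (pairIndex true l))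
  cases b l
  · simp only [Bool.not_false]
    linear_combination (-bitSign R (F (pairIndex true l))) * h0
  · simp only [Bool.not_true]
    linear_combination (-bitSign R (F (pairIndex false l))) * h1

/-- The amplitude of the superposition over the randomness `ω` of a classical protocol and over
a uniform choice of one member in each of `k` pairs. -/
noncomputable def halvingAmp {Ω : Type} (k : ℕ) (p : PMF Ω) (u : Ω × (Fin k → Bool)) : ℂ :=
  ((√((p u.1).toReal / 2 ^ k) : ℝ) : ℂ)

lemma norm_halvingAmp_sq {Ω : Type} (k : ℕ) (p : PMF Ω) (u : Ω × (Fin k → Bool)) :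
    ‖halvingAmp k p u‖ ^ 2 = (p u.1).toReal / 2 ^ k := by
  have : 0 ≤ (p u.1).toReal / 2 ^ k := by positivity
  rw [halvingAmp, Complex.norm_real, Real.norm_eq_abs, sq_abs, Real.sq_sqrt this]

/-- The basis of the workspace that holds the randomness and the choices of members. -/
noncomputable def halvingEquiv (Ω : Type) [Fintype Ω] (k : ℕ) :
    Fin (Fintype.card (Ω × (Fin k → Bool))) ≃ Ω × (Fin k → Bool) :=
  (Fintype.equivFin _).symm

lemma sum_halving {Ω : Type} [Fintype Ω] (k : ℕ) (p : PMF Ω) (P : Ω → Prop) [DecidablePred P] :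
    (∑ u, if P (halvingEquiv Ω k u).1 then ‖halvingAmp k p (halvingEquiv Ω k u)‖ ^ 2 else 0) =
      prob p {ω | P ω} := by
  rw [(halvingEquiv Ω k).sum_comp (fun u => if P u.1 then ‖halvingAmp k p u‖ ^ 2 else 0),
    Fintype.sum_prod_type, prob_setOf_eq_sum]
  refine Finset.sum_congr rfl fun ω _ => ?_
  simp only [norm_halvingAmp_sq, Finset.sum_const, Finset.card_univ, Fintype.card_fun,
    Fintype.card_bool, Fintype.card_fin, nsmul_eq_mul, Nat.cast_pow, Nat.cast_ofNat]
  split_ifs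
  · field_simp
  · simp

/-- Exchange of the members of all pairs, on the workspace. -/
noncomputable def halvingSwap (Ω : Type) [Fintype Ω] (k : ℕ)
    (u : Fin (Fintype.card (Ω × (Fin k → Bool)))) : Fin (Fintype.card (Ω × (Fin k → Bool))) :=
  (halvingEquiv Ω k).symm ((halvingEquiv Ω k u).1, fun l => !(halvingEquiv Ω k u).2 l)

lemma halvingSwap_involutive (Ω : Type) [Fintype Ω] (k : ℕ) :
    Function.Involutive (halvingSwap Ω k) := by
  intro u
  simp [halvingSwap]

/-- The state after the answers `F ω` have been written into the phase of the superposition is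
measured to the exclusive or of all `2k` answers. -/
lemma outcomeProb_halving {Ω M : Type} [Fintype Ω] [Fintype M] [DecidableEq M] (k : ℕ)
    (p : PMF Ω) (e : Fin (Fintype.card (Ω × (Fin k → Bool))) → M)
    (F : Ω → Fin (2 * k) → Bool) (x : Bool) :
    outcomeProb (flipMeasurement e (halvingSwap Ω k)) x (correlated e fun u =>
      (∏ l, bitSign ℂ (F (halvingEquiv Ω k u).1 (pairIndex ((halvingEquiv Ω k u).2 l) l))) *
        halvingAmp k p (halvingEquiv Ω k u)) = prob p {ω | xorAll (F ω) = x} := by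
  rw [outcomeProb_flipMeasurement e _ _ (fun u => xorAll (F (halvingEquiv Ω k u).1))]
  · rw [← sum_halving k p (fun ω => xorAll (F ω) = x)]
    refine Finset.sum_congr rfl fun u _ => ?_
    have : ∀ b : Bool, ‖bitSign ℂ b‖ = 1 := by intro b; cases b <;> simp
    simp [this]
  · intro u
    simp only [halvingSwap, Equiv.apply_symm_apply]
    rw [prod_bitSign_not, mul_assoc]
    rfl

theorem isLQDC_of_isXorLDC {q n m : ℕ} {δ ε : ℝ} {C : Bits n → Bits m}
    (h : IsXorLDC (2 * q) δ ε C) : IsLQDC q δ ε C := by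
  intro i
  obtain ⟨A, hA⟩ := h i
  set Eq := halvingEquiv (Fin (2 * q) → Fin m) q
  set e : Fin (Fintype.card ((Fin (2 * q) → Fin m) × (Fin q → Bool))) →
      (Fin q → Bool × Fin m) :=
    fun u l => (true, (Eq u).1 (pairIndex ((Eq u).2 l) l)) with he
  refine ⟨_, correlated e fun u => halvingAmp q A (Eq u), flipMeasurement e (halvingSwap _ q),
    ?_, isPOVM_flipMeasurement e (halvingSwap_involutive _ q), ?_⟩
  · apply isState_correlated
    have := sum_halving q A (fun _ => True)
    simpa [prob_univ] using this
  · intro x y hy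
    refine (hA x y hy).trans (le_of_eq ?_)
    rw [← outcomeProb_halving q A e (fun J l => y (J l)) (x i)]
    congr 1
    funext b
    simp only [correlated, applyQueries]
    by_cases hb : b.2 = e b.1
    · simp only [hb, if_true]
      congr 1
    · simp [hb]

lemma card_filter_apply_eq {k : ℕ} (j : Fin k) (v : Bool) :
    (Finset.univ.filter fun b : Fin k → Bool => b j = v).card * 2 = 2 ^ k := by
  have h1 : (Finset.univ.filter fun b : Fin k → Bool => b j = v).card =
      (Finset.univ.filter fun b : Fin k → Bool => ¬ b j = v).card := by
    refine Finset.card_bij' (fun b _ l => !b l) (fun b _ l => !b l) ?_ ?_ ?_ ?_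
    · intro b hb
      simp only [Finset.mem_filter, Finset.mem_univ, true_and] at hb ⊢
      simp [hb]
    · intro b hb
      simp only [Finset.mem_filter, Finset.mem_univ, true_and] at hb ⊢
      revert hb
      cases b j <;> cases v <;> simp
    · intro b _
      simp
    · intro b _
      simp
  have h2 := Finset.card_filter_add_card_filter_not (s := (Finset.univ : Finset (Fin k → Bool)))
    (fun b => b j = v)
  rw [← h1] at h2
  simp only [Finset.card_univ, Fintype.card_fun, Fintype.card_bool, Fintype.card_fin] at h2
  omega

theorem quantumPIR_of_xor {k n t : ℕ} {ε : ℝ} (S : ClassicalPIR (2 * k) n t 1 ε) (hS : S.IsXor) :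
    Nonempty (QuantumPIR k n (t + 1) (t + 1) ε) := by
  classical
  set Ω := (Fin (2 * k) → Bits t) × ((Fin (2 * k) → Bits 1) → Bool) with hΩ
  set Eq := halvingEquiv Ω k
  -- the register `j` holds the choice between the servers of pair `j` and the query to it
  set e : Fin (Fintype.card (Ω × (Fin k → Bool))) → (Fin k → Bits (t + 1)) :=
    fun u j => Fin.cons ((Eq u).2 j) ((Eq u).1.1 (pairIndex ((Eq u).2 j) j)) with he
  set phase : Fin k → Bits n → Bits (t + 1) → ℂ := fun j x c =>
    bitSign ℂ (S.server (pairIndex (c 0) j) x (Fin.tail c) 0) with hphase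
  refine ⟨{
    w := _
    query := fun i => correlated e fun u => halvingAmp k (S.user i) (Eq u)
    query_state := fun i => ?_
    r := 1
    server := fun j x _ => Matrix.diagonal (phase j x)
    server_trace := fun j x => ?_
    measurement := fun _ => flipMeasurement e (halvingSwap Ω k)
    measurement_povm := fun _ => isPOVM_flipMeasurement e (halvingSwap_involutive _ k)
    recovers := fun x i => ?_
    secret := fun j i i' => ?_ }⟩
  · apply isState_correlated
    have := sum_halving k (S.user i) (fun _ => True)
    simpa [prob_univ] using this
  · have : ∀ b : Bool, (starRingEnd ℂ) (bitSign ℂ b) * bitSign ℂ b = 1 := by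
      intro b; cases b <;> simp
    simp [Matrix.diagonal_conjTranspose, hphase, this]
  · refine (S.recovers x i).trans (le_of_eq ?_)
    rw [Fintype.sum_unique]
    have h1 : prob (S.user i) {ω | ω.2 (fun j => S.server j x (ω.1 j)) = x i} =
        prob (S.user i) {ω | xorAll (fun j => S.server j x (ω.1 j) 0) = x i} := by
      apply prob_congr_support
      intro ω hω
      simp [hS i ω hω]
    rw [h1, ← outcomeProb_halving k (S.user i) e (fun ω l => S.server l x (ω.1 l) 0) (x i)]
    congr 1
    funext b
    have h2 : applyLocal (fun j => Matrix.diagonal (phase j x))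
        (correlated e fun u => halvingAmp k (S.user i) (Eq u)) b =
        (∏ j, phase j x (b.2 j)) * correlated e (fun u => halvingAmp k (S.user i) (Eq u)) b := by
      unfold applyLocal
      rw [Finset.sum_eq_single b.2]
      · simp
      · intro Q _ hQ
        obtain ⟨j, hj⟩ := Function.ne_iff.mp hQ
        rw [Finset.prod_eq_zero (Finset.mem_univ j), zero_mul]
        exact Matrix.diagonal_apply_ne _ hj.symm
      · simp
    rw [h2]
    simp only [correlated]
    by_cases hb : b.2 = e b.1
    · simp only [hb, if_true]
      congr 1
    · simp [hb]
  · rw [reducedState_correlated, reducedState_correlated]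
    congr 1
    funext c
    congr 1
    -- the marginal distribution of a register is determined by those of two classical queries
    have key : ∀ i, (∑ u, if e u j = c then ‖halvingAmp k (S.user i) (Eq u)‖ ^ 2 else 0) =
        prob ((S.user i).map fun ω => ω.1 (pairIndex (c 0) j)) {Fin.tail c} / 2 := by
      intro i
      have h1 : ∀ u, (e u j = c) ↔ ((Eq u).1.1 (pairIndex (c 0) j) = Fin.tail c ∧
          (Eq u).2 j = c 0) := by
        intro u
        simp only [he]
        constructor
        · intro h
          rw [← h]
          simp
        · rintro ⟨h, h'⟩
          rw [h', h, Fin.cons_self_tail]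
      simp only [h1]
      rw [Eq.sum_comp (fun u : Ω × (Fin k → Bool) =>
        if u.1.1 (pairIndex (c 0) j) = Fin.tail c ∧ u.2 j = c 0 then
          ‖halvingAmp k (S.user i) u‖ ^ 2 else 0), Fintype.sum_prod_type, prob_map]
      have h3 : (fun ω : Ω => ω.1 (pairIndex (c 0) j)) ⁻¹' {Fin.tail c} =
          {ω | ω.1 (pairIndex (c 0) j) = Fin.tail c} := rfl
      rw [h3, prob_setOf_eq_sum, Finset.sum_div]
      refine Finset.sum_congr rfl fun ω _ => ?_
      simp only [norm_halvingAmp_sq]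
      by_cases h4 : ω.1 (pairIndex (c 0) j) = Fin.tail c
      · simp only [h4, true_and, if_true]
        rw [← Finset.sum_filter, Finset.sum_const, nsmul_eq_mul]
        have h5 : (Finset.univ.filter fun b : Fin k → Bool => b j = c 0).card * 2 = 2 ^ k :=
          card_filter_apply_eq j (c 0)
        have h6 : ((Finset.univ.filter fun b : Fin k → Bool => b j = c 0).card : ℝ) * 2 =
            2 ^ k := by
          exact_mod_cast h5
        rw [← h6]
        have : ((Finset.univ.filter fun b : Fin k → Bool => b j = c 0).card : ℝ) ≠ 0 := by
          intro h
          rw [h, zero_mul] at h6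
          exact (pow_pos (two_pos : (0 : ℝ) < 2) k).ne h6
        field_simp
      · simp [h4]
    rw [key, key, S.secret (pairIndex (c 0) j) i i']

/-! ### Classical schemes as quantum schemes -/

lemma isPOVM_diagonal {B : Type} [Fintype B] [DecidableEq B] (out : B → Bool) :
    IsPOVM (Matrix.diagonal fun b => if out b then (1 : ℂ) else 0) := by
  apply isPOVM_of_idempotent
  · rw [Matrix.diagonal_conjTranspose]
    congr 1
    funext b
    cases h : out b <;> simp [h]
  · rw [Matrix.diagonal_mul_diagonal]
    congr 1
    funext b
    cases out b <;> simp

lemma outcomeProb_diagonal {B : Type} [Fintype B] [DecidableEq B] (out : B → Bool) (x : Bool)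
    (v : B → ℂ) : outcomeProb (Matrix.diagonal fun b => if out b then (1 : ℂ) else 0) x v =
      ∑ b, if out b = x then ‖v b‖ ^ 2 else 0 := by
  unfold outcomeProb
  rw [dotProduct, Complex.re_sum]
  refine Finset.sum_congr rfl fun b _ => ?_
  have h1 : ((starRingEnd ℂ) (v b) * v b).re = ‖v b‖ ^ 2 := by
    rw [Complex.conj_mul', ← Complex.ofReal_pow, Complex.ofReal_re]
  have h1' : (v b).re * (v b).re + (v b).im * (v b).im = ‖v b‖ ^ 2 := by
    rw [← h1]
    simp
  cases x <;> cases h : out b <;> simp [Matrix.sub_mulVec, Matrix.mulVec_diagonal, h, h1']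

/-- A classical scheme is a quantum scheme: the user keeps a copy of the randomness, and the
servers measure the queries in the computational basis. -/
theorem ClassicalPIR.toQuantum {k n t a : ℕ} {ε : ℝ} (S : ClassicalPIR k n t a ε) :
    Nonempty (QuantumPIR k n t a ε) := by
  classical
  set Ω := (Fin k → Bits t) × ((Fin k → Bits a) → Bool) with hΩ
  set E : Fin (Fintype.card Ω) ≃ Ω := (Fintype.equivFin Ω).symm
  set R : Fin (Fintype.card (Bits t)) ≃ Bits t := (Fintype.equivFin (Bits t)).symm
  set e : Fin (Fintype.card Ω) → (Fin k → Bits t) := fun u => (E u).1 with he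
  set g : Fin n → Fin (Fintype.card Ω) → ℂ :=
    fun i u => ((√((S.user i (E u)).toReal) : ℝ) : ℂ) with hg
  have hnorm : ∀ i u, ‖g i u‖ ^ 2 = (S.user i (E u)).toReal := by
    intro i u
    rw [hg, Complex.norm_real, Real.norm_eq_abs, sq_abs, Real.sq_sqrt ENNReal.toReal_nonneg]
  refine ⟨{
    w := _
    query := fun i => correlated e (g i)
    query_state := fun i => ?_
    r := _
    server := fun j x q => Matrix.of fun b c => if c = R q ∧ b = S.server j x c then 1 else 0
    server_trace := fun j x => ?_
    measurement := fun i => Matrix.diagonal fun b => if (E b.1).2 b.2 then 1 else 0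
    measurement_povm := fun i => isPOVM_diagonal _
    recovers := fun x i => ?_
    secret := fun j i i' => ?_ }⟩
  · apply isState_correlated
    simp only [hnorm]
    rw [E.sum_comp (fun ω => (S.user i ω).toReal), sum_toReal_eq_one]
  · ext c c'
    rw [Matrix.sum_apply]
    have h1 : ∀ q, ((Matrix.of fun b c => if c = R q ∧ b = S.server j x c then (1 : ℂ) else 0)ᴴ *
        (Matrix.of fun b c => if c = R q ∧ b = S.server j x c then (1 : ℂ) else 0)) c c' =
        if c = R q then if c' = R q then 1 else 0 else 0 := by
      intro q
      rw [Matrix.mul_apply, Finset.sum_eq_single (S.server j x c)]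
      · by_cases h : c = R q
        · by_cases h' : c' = R q
          · simp [h, h']
          · simp [h']
        · simp [h]
      · intro b _ hb
        simp [hb]
      · simp
    simp only [h1]
    rw [R.sum_comp (fun q => if c = q then if c' = q then (1 : ℂ) else 0 else 0)]
    simp [Matrix.one_apply, eq_comm]
  · refine (S.recovers x i).trans (le_of_eq ?_)
    set ans : Fin (Fintype.card Ω) → (Fin k → Bits a) := fun u j => S.server j x (e u j) with hans
    have h1 : ∀ q : Fin k → Fin (Fintype.card (Bits t)),
        applyLocal (fun j => Matrix.of fun b c => if c = R (q j) ∧ b = S.server j x c then 1 else 0)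
          (correlated e (g i)) =
        correlated ans fun u => if (fun j => R (q j)) = e u then g i u else 0 := by
      intro q
      funext b
      unfold applyLocal
      rw [Finset.sum_eq_single (e b.1)]
      · simp only [correlated, if_true, Matrix.of_apply]
        rw [Finset.prod_ite_zero]
        simp only [Finset.prod_const_one, Finset.mem_univ, true_imp_iff, forall_and]
        have h2 : (∀ j, e b.1 j = R (q j)) ↔ (fun j => R (q j)) = e b.1 := by
          rw [funext_iff]
          exact forall_congr' fun j => eq_comm
        have h3 : (∀ j, b.2 j = S.server j x (e b.1 j)) ↔ b.2 = ans b.1 := by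
          rw [funext_iff]
        simp only [h2, h3]
        by_cases h4 : b.2 = ans b.1 <;> by_cases h5 : (fun j => R (q j)) = e b.1 <;>
          simp [h4, h5]
      · intro Q _ hQ
        simp [correlated, hQ]
      · simp
    simp only [h1, outcomeProb_diagonal]
    have h6 : ∀ q : Fin k → Fin (Fintype.card (Bits t)),
        (∑ b, if (E b.1).2 b.2 = x i then
          ‖correlated ans (fun u => if (fun j => R (q j)) = e u then g i u else 0) b‖ ^ 2 else 0) =
        ∑ u, if (fun j => R (q j)) = e u then
          (if (E u).2 (ans u) = x i then (S.user i (E u)).toReal else 0) else 0 := by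
      intro q
      rw [sum_correlated ans _ (fun u c hc => by simp [correlated, hc])]
      refine Finset.sum_congr rfl fun u _ => ?_
      rw [← hnorm]
      simp only [correlated, if_true]
      split_ifs <;> simp
    simp only [h6]
    rw [Finset.sum_comm, prob_setOf_eq_sum, ← E.sum_comp]
    refine Finset.sum_congr rfl fun u _ => ?_
    refine Eq.trans ?_ ((Equiv.piCongrRight fun _ : Fin k => R).sum_comp (fun q => if q = e u then
      (if (E u).2 (ans u) = x i then (S.user i (E u)).toReal else 0) else 0)).symm
    simp [hans, he]
  · rw [reducedState_correlated, reducedState_correlated]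
    congr 1
    funext c
    congr 1
    have key : ∀ i, (∑ u, if e u j = c then ‖g i u‖ ^ 2 else 0) =
        prob ((S.user i).map fun ω => ω.1 j) {c} := by
      intro i
      rw [prob_map]
      have h3 : (fun ω : Ω => ω.1 j) ⁻¹' {c} = {ω | ω.1 j = c} := rfl
      rw [h3, prob_setOf_eq_sum, ← E.sum_comp]
      simp only [hnorm, he]
    rw [key, key, S.secret j i i']

/-- A further server may be added; its query is constant and its answer is ignored. -/
theorem ClassicalPIR.addServer {k n t a : ℕ} {ε : ℝ} (S : ClassicalPIR k n t a ε) :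
    Nonempty (ClassicalPIR (k + 1) n t a ε) := by
  refine ⟨{
    user := fun i => (S.user i).map fun ω =>
      (Fin.cons (fun _ => false) ω.1, fun ans => ω.2 (Fin.tail ans))
    server := fun j x => Fin.cases (motive := fun _ => Bits t → Bits a) (fun _ _ => false)
      (fun j => S.server j x) j
    recovers := fun x i => ?_
    secret := fun j i i' => ?_ }⟩
  · rw [prob_map]
    exact S.recovers x i
  · rw [PMF.map_comp, PMF.map_comp]
    cases j using Fin.cases with
    | zero =>
      have : ∀ i, (S.user i).map ((fun ω : (Fin (k + 1) → Bits t) × ((Fin (k + 1) → Bits a) → Bool)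
          => ω.1 0) ∘ fun ω => (Fin.cons (fun _ => false) ω.1, fun ans => ω.2 (Fin.tail ans))) =
          PMF.pure fun _ => false := fun i => PMF.map_const _ _
      rw [this, this]
    | succ j => exact S.secret j i i'

/-! ### Smooth decoders -/

lemma prob_uniform {Z : Type} [Fintype Z] [Nonempty Z] (P : Z → Prop) [DecidablePred P] :
    prob (PMF.uniformOfFintype Z) {z | P z} =
      ((Finset.univ.filter P).card : ℝ) / Fintype.card Z := by
  rw [prob_setOf_eq_sum, ← Finset.sum_filter]
  simp [div_eq_mul_inv]

/-- If the exclusive or of `q` positions, each of which is an injective function of a uniform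
`z`, always yields the right bit of an uncorrupted codeword, then by the union bound an error of
weight `δ m` spoils the answer with probability at most `q δ m / |Z|`. -/
theorem isXorLDC_of_injective {n m q : ℕ} {δ ε : ℝ} {C : Bits n → Bits m} {Z : Type} [Fintype Z]
    [Nonempty Z] (hε : q * (δ * m) ≤ (1 / 2 - ε) * Fintype.card Z)
    (dec : ∀ i, ∃ pos : Fin q → Z → Fin m, (∀ l, Function.Injective (pos l)) ∧
      ∀ x z, xorAll (fun l => C x (pos l z)) = x i) : IsXorLDC q δ ε C := by
  classical
  intro i
  obtain ⟨pos, hpos, hdec⟩ := dec i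
  refine ⟨(PMF.uniformOfFintype Z).map fun z l => pos l z, fun x y hy => ?_⟩
  rw [prob_map]
  have h0 : (fun (z : Z) (l : Fin q) => pos l z) ⁻¹' {J | xorAll (fun l => y (J l)) = x i} =
      {z | xorAll (fun l => y (pos l z)) = x i} := rfl
  rw [h0, prob_uniform]
  have hZ : (0 : ℝ) < Fintype.card Z := by exact_mod_cast Fintype.card_pos
  set good := Finset.univ.filter fun z => xorAll (fun l => y (pos l z)) = x i
  set bad := Finset.univ.filter fun z => ¬ xorAll (fun l => y (pos l z)) = x i
  have h1 : good.card + bad.card = Fintype.card Z :=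
    Finset.card_filter_add_card_filter_not _
  have h2 : bad.card ≤ q * hammingDist (C x) y := by
    have hsub : bad ⊆ Finset.univ.biUnion fun l : Fin q =>
        Finset.univ.filter fun z => C x (pos l z) ≠ y (pos l z) := by
      intro z hz
      simp only [bad, Finset.mem_filter, Finset.mem_univ, true_and] at hz
      simp only [Finset.mem_biUnion, Finset.mem_filter, Finset.mem_univ, true_and]
      by_contra! hall
      apply hz
      rw [← hdec x z]
      congr 1
      funext l
      exact (hall l).symm
    calc bad.card ≤ _ := Finset.card_le_card hsub
      _ ≤ ∑ l : Fin q, (Finset.univ.filter fun z => C x (pos l z) ≠ y (pos l z)).card :=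
        Finset.card_biUnion_le
      _ ≤ ∑ _l : Fin q, hammingDist (C x) y := by
        refine Finset.sum_le_sum fun l _ => ?_
        refine Finset.card_le_card_of_injOn (pos l) ?_ ((hpos l).injOn)
        intro z hz
        simpa using hz
      _ = q * hammingDist (C x) y := by simp
  have h1' : (good.card : ℝ) + bad.card = Fintype.card Z := by exact_mod_cast h1
  have h2' : (bad.card : ℝ) ≤ q * hammingDist (C x) y := by exact_mod_cast h2
  rw [le_div_iff₀ hZ]
  have h3 : (q : ℝ) * hammingDist (C x) y ≤ q * (δ * m) :=
    mul_le_mul_of_nonneg_left hy (Nat.cast_nonneg q)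
  linarith

/-- Two further queries may be made to one and the same position. -/
theorem IsXorLDC.add_two {n m q : ℕ} {δ ε : ℝ} {C : Bits n → Bits m}
    (h : IsXorLDC (q + 1) δ ε C) : IsXorLDC (q + 1 + 2) δ ε C := by
  intro i
  obtain ⟨A, hA⟩ := h i
  refine ⟨A.map fun J => Fin.cons (J 0) (Fin.cons (J 0) J), fun x y hy => ?_⟩
  rw [prob_map]
  refine (hA x y hy).trans (le_of_eq ?_)
  congr 1
  ext J
  simp only [Set.mem_ofPred_eq, Set.mem_preimage]
  have : xorAll (fun l => y ((Fin.cons (J 0) (Fin.cons (J 0) J) : Fin (q + 1 + 2) → Fin m) l)) =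
      xorAll (fun l => y (J l)) := by
    apply bitSign_real_injective
    rw [bitSign_xorAll, bitSign_xorAll, Fin.prod_univ_succ, Fin.prod_univ_succ]
    simp only [Fin.cons_zero, Fin.cons_succ]
    rw [← mul_assoc, bitSign_mul_self, one_mul]
  rw [this]

theorem IsXorLDC.isLDC {n m q : ℕ} {δ ε : ℝ} {C : Bits n → Bits m} (h : IsXorLDC q δ ε C) :
    IsLDC q δ ε C := by
  classical
  intro i
  obtain ⟨A, hA⟩ := h i
  refine ⟨A.map fun J => (Finset.univ.image J, fun y => xorAll fun l => y (J l)), ?_, ?_⟩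
  · intro ω hω
    obtain ⟨J, -, rfl⟩ := (PMF.mem_support_map_iff _ _ _).mp hω
    refine ⟨Finset.card_image_le.trans (by simp), ?_⟩
    intro y y' hyy
    simp only
    congr 1
    funext l
    exact hyy (J l) (by simp)
  · intro x y hy
    rw [prob_map]
    exact hA x y hy

/-! ### The Hadamard code -/

theorem exists_hadamardCode (n : ℕ) (δ : ℝ) :
    ∃ C : Bits n → Bits (2 ^ n), IsLDC 2 δ (1 / 2 - 2 * δ) C := by
  have hcard : Fintype.card (Bits n) = 2 ^ n := by simp [Bits]
  set E : Bits n ≃ Fin (2 ^ n) := Fintype.equivFinOfCardEq hcard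
  refine ⟨fun x c => xorAll fun j => x j && E.symm c j, IsXorLDC.isLDC ?_⟩
  refine isXorLDC_of_injective (Z := Bits n) ?_ fun i => ?_
  · rw [hcard]
    push_cast
    linarith
  · refine ⟨fun l z => E (Function.update z i (xor (z i) (l == 0))), ?_, ?_⟩
    · intro l z z' h
      have h1 := E.injective h
      funext j
      by_cases hj : j = i
      · subst hj
        simpa using congrFun h1 j
      · simpa [hj] using congrFun h1 j
    · intro x z
      apply bitSign_real_injective
      rw [bitSign_xorAll]
      simp only [Fin.prod_univ_two, Equiv.symm_apply_apply, bitSign_xorAll]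
      rw [← Finset.prod_mul_distrib, Finset.prod_eq_single i]
      · simp
        cases x i <;> cases z i <;> simp
      · intro j _ hj
        simp [hj, bitSign_mul_self]
      · simp

/-! ### Set systems with restricted intersections modulo two primes -/

/-- By Lucas' theorem the binomial coefficient `z choose (p ^ e - 1)` is, modulo `p`, the indicator
of `z ≡ -1` modulo `p ^ e`. -/
lemma choose_prime_pow_sub_one {p : ℕ} (hp : p.Prime) (e z : ℕ) :
    ((z.choose (p ^ e - 1) : ℕ) : ZMod p) = if p ^ e ∣ z + 1 then 1 else 0 := by
  have : Fact p.Prime := ⟨hp⟩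
  induction e generalizing z with
  | zero => simp
  | succ e ih =>
    have hp0 : 0 < p := hp.pos
    have hpe : 0 < p ^ e := pow_pos hp0 e
    have hk : p ^ (e + 1) - 1 = (p - 1) + p * (p ^ e - 1) := by
      rw [pow_succ, Nat.mul_sub, mul_comm (p ^ e) p, mul_one]
      have : p ≤ p * p ^ e := Nat.le_mul_of_pos_right p hpe
      omega
    have hmod : (p ^ (e + 1) - 1) % p = p - 1 := by
      rw [hk, Nat.add_mul_mod_self_left]
      exact Nat.mod_eq_of_lt (by omega)
    have hdiv : (p ^ (e + 1) - 1) / p = p ^ e - 1 := by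
      rw [hk, Nat.add_mul_div_left _ _ hp0, Nat.div_eq_of_lt (by omega), zero_add]
    have hl := Choose.choose_modEq_choose_mod_mul_choose_div_nat (n := z) (k := p ^ (e + 1) - 1)
      (p := p)
    rw [hmod, hdiv] at hl
    rw [(ZMod.natCast_eq_natCast_iff _ _ _).mpr hl]
    push_cast
    rw [ih]
    have hr : z % p < p := Nat.mod_lt _ hp0
    have hz : p * (z / p) + z % p = z := Nat.div_add_mod z p
    by_cases h : z % p = p - 1
    · rw [h, Nat.choose_self, Nat.cast_one, one_mul]
      have : p ^ (e + 1) ∣ z + 1 ↔ p ^ e ∣ z / p + 1 := by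
        have hz' : z + 1 = p * (z / p + 1) := by
          rw [mul_add, mul_one]
          omega
        rw [hz', pow_succ, mul_comm (p ^ e) p]
        exact Nat.mul_dvd_mul_iff_left hp0
      simp only [this]
    · have hlt : z % p < p - 1 := by omega
      rw [Nat.choose_eq_zero_of_lt hlt, Nat.cast_zero, zero_mul, if_neg]
      intro hd
      have h1 : p ∣ z + 1 := (dvd_pow_self p (Nat.succ_ne_zero e)).trans hd
      rw [← hz, add_assoc, Nat.dvd_add_right (dvd_mul_right _ _)] at h1
      have := Nat.le_of_dvd (Nat.succ_pos _) h1
      omega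

/-- The graph of a function between finite types. -/
def graphFinset {w s : ℕ} (f : Fin w → Fin s) : Finset (Fin w × Fin s) :=
  Finset.univ.image fun a => (a, f a)

lemma mem_graphFinset {w s : ℕ} {f : Fin w → Fin s} {v : Fin w × Fin s} :
    v ∈ graphFinset f ↔ f v.1 = v.2 := by
  simp only [graphFinset, Finset.mem_image, Finset.mem_univ, true_and]
  exact ⟨fun ⟨a, h⟩ => by rw [← h], fun h => ⟨v.1, Prod.ext rfl h⟩⟩

lemma card_graphFinset_inter {w s : ℕ} (f g : Fin w → Fin s) :
    (graphFinset f ∩ graphFinset g).card = (Finset.univ.filter fun a => f a = g a).card := by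
  have : graphFinset f ∩ graphFinset g =
      (Finset.univ.filter fun a => f a = g a).image fun a => (a, f a) := by
    ext v
    simp only [Finset.mem_inter, mem_graphFinset, Finset.mem_image, Finset.mem_univ, true_and,
      Finset.mem_filter]
    constructor
    · rintro ⟨h, h'⟩
      exact ⟨v.1, h.trans h'.symm, Prod.ext rfl h⟩
    · rintro ⟨a, h, rfl⟩
      exact ⟨rfl, h.symm⟩
  rw [this, Finset.card_image_of_injective]
  exact fun _ _ h => (Prod.ext_iff.mp h).1

/-- Two functions with `z` agreements have `z choose d` common `d`-subsets of their graphs; the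
`d`-subsets of the product are numbered. -/
lemma exists_finset_card_inter_eq_choose (w s d h : ℕ) (hh : (w * s) ^ d ≤ h) :
    ∃ U : (Fin w → Fin s) → Finset (Fin h), ∀ f g,
      (U f ∩ U g).card = (Finset.univ.filter fun a => f a = g a).card.choose d := by
  classical
  set S : Finset (Finset (Fin w × Fin s)) := Finset.powersetCard d Finset.univ with hS
  have hcard : Fintype.card S ≤ Fintype.card (Fin h) := by
    rw [Fintype.card_coe, Fintype.card_fin, hS, Finset.card_powersetCard, Finset.card_univ,
      Fintype.card_prod, Fintype.card_fin, Fintype.card_fin]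
    exact (Nat.choose_le_pow _ _).trans hh
  obtain ⟨φ⟩ := Function.Embedding.nonempty_of_card_le hcard
  refine ⟨fun f => ((Finset.powersetCard d (graphFinset f)).subtype (· ∈ S)).map φ, fun f g => ?_⟩
  have h1 : (Finset.powersetCard d (graphFinset f)).subtype (· ∈ S) ∩
      (Finset.powersetCard d (graphFinset g)).subtype (· ∈ S) =
      (Finset.powersetCard d (graphFinset f ∩ graphFinset g)).subtype (· ∈ S) := by
    ext T
    simp only [Finset.mem_inter, Finset.mem_subtype, Finset.mem_powersetCard,
      Finset.subset_inter_iff]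
    tauto
  rw [← Finset.map_inter, h1, Finset.card_map, Finset.card_subtype, Finset.filter_true_of_mem,
    Finset.card_powersetCard, card_graphFinset_inter]
  intro T hT
  rw [Finset.mem_powersetCard] at hT
  rw [hS, Finset.mem_powersetCard]
  exact ⟨Finset.subset_univ _, hT.2⟩

/-- Two families of `n` subsets of an `h`-element set. All intersections have size `0` or `1`
modulo `p`, respectively `q`, and both remainders are `1` just for the intersection of two sets with
the same index. -/
structure MatchingFamily (p q n h : ℕ) where
  U : Fin n → Finset (Fin h)
  V : Fin n → Finset (Fin h)
  card_U : ∀ i j, ((U i ∩ U j).card : ZMod p) = 0 ∨ ((U i ∩ U j).card : ZMod p) = 1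
  card_V : ∀ i j, ((V i ∩ V j).card : ZMod q) = 0 ∨ ((V i ∩ V j).card : ZMod q) = 1
  eq_iff : ∀ i j, (((U i ∩ U j).card : ZMod p) = 1 ∧ ((V i ∩ V j).card : ZMod q) = 1) ↔ i = j

/-- If `w = p ^ a q ^ b - 1`, then two functions on `w` points are equal as soon as the number `z`
of their agreements is `-1` modulo `p ^ a` and modulo `q ^ b`. -/
lemma exists_matchingFamily {p q : ℕ} (hp : p.Prime) (hq : q.Prime) (hpq : p ≠ q) (a b s n h : ℕ)
    (hU : ((p ^ a * q ^ b - 1) * s) ^ (p ^ a - 1) ≤ h)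
    (hV : ((p ^ a * q ^ b - 1) * s) ^ (q ^ b - 1) ≤ h)
    (hn : n ≤ s ^ (p ^ a * q ^ b - 1)) : Nonempty (MatchingFamily p q n h) := by
  have : Fact p.Prime := ⟨hp⟩
  have : Fact q.Prime := ⟨hq⟩
  set w := p ^ a * q ^ b - 1 with hw
  have hw1 : w + 1 = p ^ a * q ^ b := by
    have : 0 < p ^ a * q ^ b := Nat.mul_pos (pow_pos hp.pos a) (pow_pos hq.pos b)
    omega
  have hcard : Fintype.card (Fin n) ≤ Fintype.card (Fin w → Fin s) := by simpa using hn
  obtain ⟨f⟩ := Function.Embedding.nonempty_of_card_le hcard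
  obtain ⟨U, hU⟩ := exists_finset_card_inter_eq_choose w s (p ^ a - 1) h hU
  obtain ⟨V, hV⟩ := exists_finset_card_inter_eq_choose w s (q ^ b - 1) h hV
  refine ⟨⟨fun i => U (f i), fun i => V (f i), fun i j => ?_, fun i j => ?_, fun i j => ?_⟩⟩
  · rw [hU, choose_prime_pow_sub_one hp]
    split_ifs <;> simp
  · rw [hV, choose_prime_pow_sub_one hq]
    split_ifs <;> simp
  · rw [hU, hV, choose_prime_pow_sub_one hp, choose_prime_pow_sub_one hq]
    set z := (Finset.univ.filter fun x => f i x = f j x).card with hz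
    have hp1 : (if p ^ a ∣ z + 1 then (1 : ZMod p) else 0) = 1 ↔ p ^ a ∣ z + 1 := by
      split_ifs with h <;> simp [h]
    have hq1 : (if q ^ b ∣ z + 1 then (1 : ZMod q) else 0) = 1 ↔ q ^ b ∣ z + 1 := by
      split_ifs with h <;> simp [h]
    rw [hp1, hq1]
    have hzw : z ≤ w := (Finset.card_le_univ _).trans (by simp)
    constructor
    · rintro ⟨h1, h2⟩
      have hcop : Nat.Coprime (p ^ a) (q ^ b) :=
        Nat.Coprime.pow a b ((Nat.coprime_primes hp hq).mpr hpq)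
      have h3 := Nat.le_of_dvd (Nat.succ_pos z) (hcop.mul_dvd_of_dvd_of_dvd h1 h2)
      have h4 : z = Fintype.card (Fin w) := by
        rw [Fintype.card_fin]
        omega
      rw [hz, Finset.card_eq_iff_eq_univ] at h4
      apply f.injective
      funext x
      have h5 : x ∈ Finset.univ.filter fun x => f i x = f j x := by
        rw [h4]
        exact Finset.mem_univ x
      exact (Finset.mem_filter.mp h5).2
    · rintro rfl
      have : z = w := by simp [hz]
      rw [this, hw1]
      exact ⟨dvd_mul_right _ _, dvd_mul_left _ _⟩

/-- The size of the ground set is a small power of the number of sets, since the exponents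
`p ^ a - 1` and `q ^ b - 1` are much smaller than `w = p ^ a q ^ b - 1`. -/
lemma exists_matchingFamily_le {p q : ℕ} (hp : p.Prime) (hq : q.Prime) (hpq : p ≠ q) (a b d : ℕ)
    (α : ℝ) (ha : p ^ a - 1 ≤ d) (hb : q ^ b - 1 ≤ d) (hw : 0 < p ^ a * q ^ b - 1)
    (hα : (d : ℝ) / (p ^ a * q ^ b - 1 : ℕ) ≤ α) :
    ∃ c : ℝ, 0 ≤ c ∧ ∀ n : ℕ, 1 ≤ n → ∃ h : ℕ,
      Nonempty (MatchingFamily p q n h) ∧ (h : ℝ) ≤ c * (n : ℝ) ^ α := by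
  set w := p ^ a * q ^ b - 1 with hw'
  refine ⟨(2 * w : ℝ) ^ d, by positivity, fun n hn => ?_⟩
  have hn1 : (1 : ℝ) ≤ n := by exact_mod_cast hn
  have hw0 : (0 : ℝ) < w := by exact_mod_cast hw
  set r : ℝ := (n : ℝ) ^ (1 / w : ℝ) with hr
  have hr1 : 1 ≤ r := Real.one_le_rpow hn1 (by positivity)
  set s := ⌈r⌉₊ with hs
  have hs1 : 1 ≤ s := Nat.one_le_ceil_iff.mpr (by linarith)
  have hs2 : (s : ℝ) ≤ 2 * r := by
    have := Nat.ceil_lt_add_one (show 0 ≤ r by linarith)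
    linarith
  have hrw : r ^ w = n := by
    rw [hr, ← Real.rpow_natCast, ← Real.rpow_mul (by linarith), one_div_mul_cancel hw0.ne',
      Real.rpow_one]
  have hws : 1 ≤ w * s := Nat.mul_pos hw hs1
  refine ⟨(w * s) ^ d, exists_matchingFamily hp hq hpq a b s n _
    (Nat.pow_le_pow_right hws ha) (Nat.pow_le_pow_right hws hb) ?_, ?_⟩
  · have : (n : ℝ) ≤ (s : ℝ) ^ w := by
      rw [← hrw]
      exact pow_le_pow_left₀ (by linarith) (Nat.le_ceil r) w
    exact_mod_cast this
  · push_cast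
    calc ((w : ℝ) * s) ^ d ≤ (w * (2 * r)) ^ d := by gcongr
      _ = (2 * w : ℝ) ^ d * r ^ d := by rw [← mul_pow]; ring
      _ ≤ (2 * w : ℝ) ^ d * (n : ℝ) ^ α := by
        gcongr
        rw [hr, ← Real.rpow_natCast, ← Real.rpow_mul (by linarith)]
        apply Real.rpow_le_rpow_of_exponent_le hn1
        rw [one_div_mul_eq_div]
        exact hα

/-! ### Two-server private information retrieval -/

lemma map_uniformOfFintype_equiv {Z Z' : Type} [Fintype Z] [Nonempty Z] [Fintype Z'] [Nonempty Z']
    (E : Z ≃ Z') : (PMF.uniformOfFintype Z).map E = PMF.uniformOfFintype Z' := by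
  classical
  ext y
  rw [PMF.map_apply, tsum_eq_single (E.symm y)]
  · simp [Fintype.card_congr E]
  · intro z hz
    rw [if_neg]
    rintro rfl
    simp at hz

/-- Multiplying the coordinates in `A` by a power of `g` multiplies the monomial of `B` by that
power of `g ^ #(B ∩ A)`. -/
lemma prod_mul_ite_mem {ι R : Type*} [DecidableEq ι] [CommMonoid R] (A B : Finset ι) (g : R)
    (z : ι → R) : ∏ k ∈ B, z k * (if k ∈ A then g else 1) = (∏ k ∈ B, z k) * g ^ (B ∩ A).card := by
  rw [Finset.prod_mul_distrib, Finset.prod_ite_mem, Finset.prod_const]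

lemma pow_card_of_mod {p c : ℕ} (hp : 1 < p) {R : Type*} [Monoid R] {g : R}
    (hg : g ^ p = 1) :
    ((c : ZMod p) = 0 → g ^ c = 1) ∧ ((c : ZMod p) = 1 → g ^ c = g) := by
  constructor
  · intro h
    obtain ⟨k, rfl⟩ := (ZMod.natCast_eq_zero_iff _ _).mp h
    rw [pow_mul, hg, one_pow]
  · intro h
    rw [← Nat.cast_one, ZMod.natCast_eq_natCast_iff, Nat.ModEq, Nat.mod_eq_of_lt hp] at h
    rw [← Nat.mod_add_div c p, h, pow_add, pow_mul, hg, one_pow, pow_one, mul_one]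

/-- The `T`-th component of the answer to the query `z` for the database `x`, modulo `3`: the sum of
the terms `x i * ∏ k ∈ U i, (-1) ^ z k` over those `i` with `T ∈ V i`. The sum of the components
in `V τ` gives the `i`-th term the weight `#(V i ∩ V τ)`. -/
def matchingAnswer {n h : ℕ} (F : MatchingFamily 2 3 n h) (x : Bits n) (z : Bits h) (T : Fin h) :
    ZMod 3 :=
  ∑ i, (if x i then 1 else 0) * (∏ k ∈ F.U i, bitSign (ZMod 3) (z k)) *
    (if T ∈ F.V i then 1 else 0)

/-- The query point `z` with the coordinates in `A` negated. -/
def negateOn {h : ℕ} (A : Finset (Fin h)) (z : Bits h) : Bits h := fun k => xor (z k) (k ∈ A)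

lemma negateOn_involutive {h : ℕ} (A : Finset (Fin h)) : Function.Involutive (negateOn A) := by
  intro z
  funext k
  simp [negateOn]

/-- Of the two factors of the `i`-th term, `#(V i ∩ V τ)` and `1 - (-1) ^ #(U i ∩ U τ)`, one
vanishes unless `i = τ`. -/
lemma sum_matchingAnswer_sub {n h : ℕ} (F : MatchingFamily 2 3 n h) (x : Bits n) (z : Bits h)
    (τ : Fin n) :
    ∑ T ∈ F.V τ, (matchingAnswer F x z T - matchingAnswer F x (negateOn (F.U τ) z) T) =
      (if x τ then 1 else 0) * (∏ k ∈ F.U τ, bitSign (ZMod 3) (z k)) * 2 := by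
  have h1 : ∀ i, (∏ k ∈ F.U i, bitSign (ZMod 3) (negateOn (F.U τ) z k)) =
      (∏ k ∈ F.U i, bitSign (ZMod 3) (z k)) * (-1) ^ (F.U i ∩ F.U τ).card := by
    intro i
    rw [← prod_mul_ite_mem]
    refine Finset.prod_congr rfl fun k _ => ?_
    by_cases hk : k ∈ F.U τ <;> simp [negateOn, hk, bitSign_not]
  have h2 : ∀ i, ∑ T ∈ F.V τ, (if T ∈ F.V i then (1 : ZMod 3) else 0) =
      ((F.V i ∩ F.V τ).card : ZMod 3) := by
    intro i
    rw [Finset.inter_comm, ← Finset.filter_mem_eq_inter, Finset.sum_boole]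
  simp only [matchingAnswer, ← Finset.sum_sub_distrib, h1]
  rw [Finset.sum_comm, Finset.sum_eq_single τ]
  · simp only [← sub_mul, ← mul_sub, ← Finset.mul_sum]
    rw [h2, ((F.eq_iff τ τ).mpr rfl).2,
      (pow_card_of_mod one_lt_two (by norm_num)).2 ((F.eq_iff τ τ).mpr rfl).1]
    ring
  · intro i _ hi
    simp only [← sub_mul, ← mul_sub, ← Finset.mul_sum]
    rw [h2]
    rcases F.card_V i τ with hV | hV
    · rw [hV, mul_zero]
    · rcases F.card_U i τ with hU | hU
      · rw [(pow_card_of_mod one_lt_two (by norm_num)).1 hU]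
        ring
      · exact absurd ((F.eq_iff i τ).mp ⟨hU, hV⟩) hi
  · simp

/-- The two queries are a uniform point and the same point with the coordinates in `U τ` negated,
where `τ` is the wanted index; each is uniformly distributed. -/
theorem MatchingFamily.classicalPIR {n h : ℕ} (F : MatchingFamily 2 3 n h) :
    Nonempty (ClassicalPIR 2 n h (2 * h) (1 / 2)) := by
  classical
  have hcard : Fintype.card (Fin h → ZMod 3) ≤ Fintype.card (Bits (2 * h)) := by
    simp only [Fintype.card_fun, ZMod.card, Fintype.card_fin, Fintype.card_bool]
    rw [pow_mul]
    exact Nat.pow_le_pow_left (by norm_num) h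
  obtain ⟨enc⟩ := Function.Embedding.nonempty_of_card_le hcard
  set dec := Function.invFun enc with hdec
  have hde : ∀ v, dec (enc v) = v := Function.leftInverse_invFun enc.injective
  refine ⟨{
    user := fun τ => (PMF.uniformOfFintype (Bits h)).map fun z => (![z, negateOn (F.U τ) z],
      fun ans => decide (∑ T ∈ F.V τ, (dec (ans 0) T - dec (ans 1) T) ≠ 0))
    server := fun _ x z => enc (matchingAnswer F x z)
    recovers := fun x τ => ?_
    secret := fun j τ τ' => ?_ }⟩
  · rw [prob_map]
    refine (le_trans (by norm_num) (prob_univ (PMF.uniformOfFintype (Bits h))).ge).trans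
      (le_of_eq ?_)
    congr 1
    symm
    rw [Set.eq_univ_iff_forall]
    intro z
    simp only [Set.mem_preimage, Set.mem_ofPred_eq, Matrix.cons_val_zero, Matrix.cons_val_one, hde,
      sum_matchingAnswer_sub]
    have h3 : (∏ k ∈ F.U τ, bitSign (ZMod 3) (z k)) * 2 ≠ 0 := by
      have : Fact (Nat.Prime 3) := ⟨Nat.prime_three⟩
      refine mul_ne_zero (Finset.prod_ne_zero_iff.mpr fun k _ => ?_) (by decide)
      cases z k <;> simp
    cases hx : x τ
    · simp
    · simpa [mul_assoc] using h3
  · rw [PMF.map_comp, PMF.map_comp]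
    have key : ∀ τ, PMF.map ((fun ω : (Fin 2 → Bits h) × ((Fin 2 → Bits (2 * h)) → Bool) => ω.1 j) ∘
        fun z => (![z, negateOn (F.U τ) z],
          fun ans => decide (∑ T ∈ F.V τ, (dec (ans 0) T - dec (ans 1) T) ≠ 0)))
        (PMF.uniformOfFintype (Bits h)) = PMF.uniformOfFintype (Bits h) := by
      intro τ
      fin_cases j
      · exact PMF.map_id _
      · exact map_uniformOfFintype_equiv (negateOn_involutive (F.U τ)).toPerm
    rw [key, key]

theorem hasClassicalPIR_two : HasClassicalPIR 2 (1 / 11) := by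
  obtain ⟨c, hc, H⟩ := exists_matchingFamily_le (p := 2) (q := 3) Nat.prime_two Nat.prime_three
    (by norm_num) 4 3 26 (1 / 11) (by norm_num) (by norm_num) (by norm_num) (by norm_num)
  refine ⟨6 * c, fun n hn => ?_⟩
  obtain ⟨h, ⟨F⟩, hh⟩ := H n hn
  refine ⟨h, 2 * h, F.classicalPIR, ?_⟩
  push_cast
  linarith

lemma HasClassicalPIR.mono {k : ℕ} {α β : ℝ} (hαβ : α ≤ β) (H : HasClassicalPIR k α) :
    HasClassicalPIR k β := by
  obtain ⟨c, H⟩ := H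
  refine ⟨max c 0, fun n hn => ?_⟩
  obtain ⟨t, a, S, hS⟩ := H n hn
  refine ⟨t, a, S, hS.trans ?_⟩
  have hn1 : (1 : ℝ) ≤ n := by exact_mod_cast hn
  exact mul_le_mul (le_max_left _ _) (Real.rpow_le_rpow_of_exponent_le hn1 hαβ) (by positivity)
    (le_max_right _ _)

lemma HasClassicalPIR.addServer {k : ℕ} {α : ℝ} (hk : 1 ≤ k) (H : HasClassicalPIR k α) :
    HasClassicalPIR (k + 1) α := by
  obtain ⟨c, H⟩ := H
  refine ⟨2 * c, fun n hn => ?_⟩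
  obtain ⟨t, a, ⟨S⟩, hS⟩ := H n hn
  refine ⟨t, a, S.addServer, ?_⟩
  have hk' : k + 1 ≤ 2 * k := by omega
  have h1 : (((k + 1) * (t + a) : ℕ) : ℝ) ≤ ((2 * (k * (t + a)) : ℕ) : ℝ) := by
    rw [← mul_assoc]
    exact_mod_cast Nat.mul_le_mul_right _ hk'
  refine h1.trans ?_
  push_cast at hS ⊢
  linarith

lemma HasClassicalPIR.toQuantum {k : ℕ} {α : ℝ} (H : HasClassicalPIR k α) :
    HasQuantumPIR k α := by
  obtain ⟨c, H⟩ := H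
  refine ⟨c, fun n hn => ?_⟩
  obtain ⟨t, a, ⟨S⟩, hS⟩ := H n hn
  exact ⟨t, a, S.toQuantum, hS⟩

/-! ### Four-query codes of the exclusive-or type -/

lemma xorAll_decide_eq_one {k : ℕ} (f : Fin k → ZMod 2) :
    xorAll (fun l => decide (f l = 1)) = decide (∑ l, f l = 1) := by
  have h1 : ∀ a : ZMod 2, a = if a = 1 then 1 else 0 := by decide
  have h2 : ∑ l, f l = ((Finset.univ.filter fun l => f l = 1).card : ZMod 2) := by
    rw [← Finset.sum_boole]
    exact Finset.sum_congr rfl fun l _ => h1 _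
  rw [h2]
  simp only [xorAll, decide_eq_true_eq, ZMod.natCast_eq_one_iff_odd]

/-- The encoding polynomial of the database `x`: the `i`-th bit is the coefficient of the monomial
`∏ k ∈ U i, z k * ∏ k ∈ V i, z' k`. It is evaluated on units of the field. -/
def matchingPoly {n h p q : ℕ} {K : Type} [Field K] (F : MatchingFamily p q n h) (x : Bits n)
    (z : (Fin h → Kˣ) × (Fin h → Kˣ)) : K :=
  ∑ i, (if x i then 1 else 0) * (((∏ k ∈ F.U i, z.1 k) * ∏ k ∈ F.V i, z.2 k : Kˣ) : K)

/-- The point `z` with the coordinates in `A`, respectively `B`, multiplied by a unit. -/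
def scaleOn {h : ℕ} {K : Type} [Field K] (A B : Finset (Fin h)) (g g' : Kˣ)
    (z : (Fin h → Kˣ) × (Fin h → Kˣ)) : (Fin h → Kˣ) × (Fin h → Kˣ) :=
  (fun k => z.1 k * (if k ∈ A then g else 1), fun k => z.2 k * (if k ∈ B then g' else 1))

lemma scaleOn_injective {h : ℕ} {K : Type} [Field K] (A B : Finset (Fin h)) (g g' : Kˣ) :
    Function.Injective (scaleOn A B g g') := by
  intro z z' hz
  have h1 := congrArg Prod.fst hz
  have h2 := congrArg Prod.snd hz
  refine Prod.ext (funext fun k => ?_) (funext fun k => ?_)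
  · exact mul_right_cancel (congrFun h1 k)
  · exact mul_right_cancel (congrFun h2 k)

/-- Summing over the four shifts multiplies the `i`-th term by `(ω ^ #(U i ∩ U τ) - 1)` and
`(ζ ^ #(V i ∩ V τ) - 1)`, one of which vanishes unless `i = τ`. -/
lemma sum_matchingPoly_scaleOn {n h p q : ℕ} {K : Type} [Field K] [CharP K 2] (hp : 1 < p)
    (hq : 1 < q) (F : MatchingFamily p q n h) {ω ζ : Kˣ} (hω : ω ^ p = 1) (hζ : ζ ^ q = 1)
    (x : Bits n) (z : (Fin h → Kˣ) × (Fin h → Kˣ)) (τ : Fin n) :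
    ∑ l : Fin 4, matchingPoly F x
        (scaleOn (F.U τ) (F.V τ) (![1, ω, 1, ω] l) (![1, 1, ζ, ζ] l) z) =
      (if x τ then 1 else 0) * (((∏ k ∈ F.U τ, z.1 k) * ∏ k ∈ F.V τ, z.2 k : Kˣ) : K) *
        ((1 + ω) * (1 + ζ)) := by
  have h1 : ∀ g g' : Kˣ, matchingPoly F x (scaleOn (F.U τ) (F.V τ) g g' z) =
      ∑ i, (if x i then 1 else 0) * (((∏ k ∈ F.U i, z.1 k) * ∏ k ∈ F.V i, z.2 k : Kˣ) : K) *
        ((g ^ (F.U i ∩ F.U τ).card : Kˣ) * (g' ^ (F.V i ∩ F.V τ).card : Kˣ)) := by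
    intro g g'
    unfold matchingPoly
    refine Finset.sum_congr rfl fun i _ => ?_
    simp only [scaleOn, prod_mul_ite_mem]
    push_cast
    ring
  simp only [h1]
  rw [Finset.sum_comm, Finset.sum_eq_single τ]
  · rw [← Finset.mul_sum]
    congr 1
    simp only [Fin.sum_univ_four, Matrix.cons_val]
    rw [(pow_card_of_mod hp hω).2 ((F.eq_iff τ τ).mpr rfl).1,
      (pow_card_of_mod hq hζ).2 ((F.eq_iff τ τ).mpr rfl).2]
    simp only [one_pow, Units.val_one]
    ring
  · intro i _ hi
    rw [← Finset.mul_sum]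
    simp only [Fin.sum_univ_four, Matrix.cons_val]
    simp only [one_pow, Units.val_one, one_mul, mul_one]
    have h2 : ∀ a : K, a + a = 0 := CharTwo.add_self_eq_zero
    rcases F.card_U i τ with hU | hU
    · rw [(pow_card_of_mod hp hω).1 hU, Units.val_one, one_mul, h2, zero_add, h2, mul_zero]
    · rcases F.card_V i τ with hV | hV
      · rw [(pow_card_of_mod hq hζ).1 hV, Units.val_one, mul_one, add_assoc, h2, mul_zero]
      · exact absurd ((F.eq_iff i τ).mp ⟨hU, hV⟩) hi
  · simp

/-- The codeword lists, for all points `z` and all `c`, the bits `L (c * P z)`, where `P` is the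
encoding polynomial and `L` a linear functional with `L 1 = 1`. The decoder chooses `c` to normalize
the coefficient of the wanted bit. -/
theorem MatchingFamily.exists_isXorLDC {n h p q : ℕ} {K : Type} [Field K] [Fintype K] [CharP K 2]
    (hp : 1 < p) (hq : 1 < q) (F : MatchingFamily p q n h) {ω ζ : Kˣ} (hω : ω ^ p = 1)
    (hω1 : ω ≠ 1) (hζ : ζ ^ q = 1) (hζ1 : ζ ≠ 1) {δ ε : ℝ}
    (hδ : 4 * δ * Fintype.card K ≤ 1 / 2 - ε) :
    ∃ m, ∃ C : Bits n → Bits m, IsXorLDC 4 δ ε C ∧ m ≤ Fintype.card K ^ (2 * h + 1) := by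
  classical
  set Z := (Fin h → Kˣ) × (Fin h → Kˣ) with hZ
  let : Algebra (ZMod 2) K := ZMod.algebra K 2
  obtain ⟨L, hL⟩ : ∃ L : Module.Dual (ZMod 2) K, L 1 = 1 := by
    have h1 : ∃ L : Module.Dual (ZMod 2) K, L 1 ≠ 0 := by
      by_contra! h
      exact one_ne_zero ((Module.forall_dual_apply_eq_zero_iff (ZMod 2) (1 : K)).mp h)
    obtain ⟨L, hL⟩ := h1
    have h2 : ∀ a : ZMod 2, a ≠ 0 → a = 1 := by decide
    exact ⟨L, h2 _ hL⟩
  set E : Z × K ≃ Fin (Fintype.card (Z × K)) := Fintype.equivFin _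
  refine ⟨_, fun x c => decide (L ((E.symm c).2 * matchingPoly F x (E.symm c).1) = 1), ?_, ?_⟩
  · refine isXorLDC_of_injective (Z := Z) ?_ fun τ => ?_
    · rw [Fintype.card_prod]
      push_cast
      have := mul_le_mul_of_nonneg_right hδ (Nat.cast_nonneg (α := ℝ) (Fintype.card Z))
      linarith
    · set N : Z → K := fun z => (((∏ k ∈ F.U τ, z.1 k) * ∏ k ∈ F.V τ, z.2 k : Kˣ) : K) *
        ((1 + ω) * (1 + ζ)) with hN
      have hne : ∀ g : Kˣ, g ≠ 1 → (1 + g : K) ≠ 0 := by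
        intro g hg h0
        apply hg
        rw [CharTwo.add_eq_zero] at h0
        exact Units.ext h0.symm
      have hN0 : ∀ z, N z ≠ 0 := fun z =>
        mul_ne_zero (Units.ne_zero _) (mul_ne_zero (hne ω hω1) (hne ζ hζ1))
      refine ⟨fun l z => E (scaleOn (F.U τ) (F.V τ) (![1, ω, 1, ω] l) (![1, 1, ζ, ζ] l) z,
        (N z)⁻¹), ?_, ?_⟩
      · intro l z z' hz
        exact scaleOn_injective _ _ _ _ (Prod.ext_iff.mp (E.injective hz)).1
      · intro x z
        simp only [Equiv.symm_apply_apply]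
        rw [xorAll_decide_eq_one, ← map_sum, ← Finset.mul_sum,
          sum_matchingPoly_scaleOn hp hq F hω hζ, mul_assoc]
        cases x τ
        · simp
        · rw [if_pos rfl, one_mul]
          change decide (L ((N z)⁻¹ * N z) = 1) = true
          rw [inv_mul_cancel₀ (hN0 z), hL, decide_eq_true rfl]
  · rw [Fintype.card_prod, Fintype.card_prod, Fintype.card_fun, Fintype.card_fin, pow_succ, two_mul,
      pow_add]
    have h3 : Fintype.card Kˣ ≤ Fintype.card K :=
      Fintype.card_le_of_injective _ Units.val_injective
    gcongr

lemma exists_unit_of_prime_dvd {K : Type} [Field K] [Fintype K] {p : ℕ} (hp : p.Prime)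
    (h : p ∣ Fintype.card K - 1) : ∃ ω : Kˣ, ω ^ p = 1 ∧ ω ≠ 1 := by
  classical
  have : Fact p.Prime := ⟨hp⟩
  rw [← Fintype.card_units] at h
  obtain ⟨ω, hω⟩ := exists_prime_orderOf_dvd_card p h
  refine ⟨ω, hω ▸ pow_orderOf_eq_one ω, ?_⟩
  rintro rfl
  rw [orderOf_one] at hω
  exact hp.one_lt.ne hω

/-- The field with `16` elements has roots of unity of orders `3` and `5`. -/
theorem exists_isXorLDC_four {ε : ℝ} (hε : ε < 1 / 2) :
    ∃ δ : ℝ, 0 < δ ∧ ∃ c : ℝ, ∀ n : ℕ, 1 ≤ n → ∃ (m : ℕ) (C : Bits n → Bits m),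
      IsXorLDC 4 δ ε C ∧ (m : ℝ) ≤ (2 : ℝ) ^ (c * (n : ℝ) ^ (1 / 11 : ℝ)) := by
  obtain ⟨c, hc, H⟩ := exists_matchingFamily_le (p := 3) (q := 5) Nat.prime_three Nat.prime_five
    (by norm_num) 3 2 26 (1 / 11) (by norm_num) (by norm_num) (by norm_num) (by norm_num)
  have : Fintype (GaloisField 2 4) := Fintype.ofFinite _
  have hK : Fintype.card (GaloisField 2 4) = 16 := by
    rw [← Nat.card_eq_fintype_card, GaloisField.card 2 4 (by norm_num)]
    norm_num
  obtain ⟨ω, hω, hω1⟩ := exists_unit_of_prime_dvd (K := GaloisField 2 4) Nat.prime_three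
    (by rw [hK]; norm_num)
  obtain ⟨ζ, hζ, hζ1⟩ := exists_unit_of_prime_dvd (K := GaloisField 2 4) Nat.prime_five
    (by rw [hK]; norm_num)
  refine ⟨(1 / 2 - ε) / 64, by linarith, 8 * c + 4, fun n hn => ?_⟩
  obtain ⟨h, ⟨F⟩, hh⟩ := H n hn
  obtain ⟨m, C, hC, hm⟩ := F.exists_isXorLDC (by norm_num) (by norm_num) hω hω1 hζ hζ1
    (δ := (1 / 2 - ε) / 64) (ε := ε) (by rw [hK]; push_cast; linarith)
  refine ⟨m, C, hC, ?_⟩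
  have hn1 : (1 : ℝ) ≤ (n : ℝ) ^ (1 / 11 : ℝ) :=
    Real.one_le_rpow (by exact_mod_cast hn) (by norm_num)
  have hm' : (m : ℝ) ≤ (2 : ℝ) ^ (8 * h + 4 : ℝ) := by
    have h1 : m ≤ 2 ^ (8 * h + 4) := by
      refine hm.trans (le_of_eq ?_)
      rw [hK, show 16 = 2 ^ 4 by norm_num, ← pow_mul]
      congr 1
      ring
    calc (m : ℝ) ≤ ((2 ^ (8 * h + 4) : ℕ) : ℝ) := by exact_mod_cast h1
      _ = (2 : ℝ) ^ (8 * h + 4 : ℝ) := by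
        rw [show (8 * h + 4 : ℝ) = ((8 * h + 4 : ℕ) : ℝ) by push_cast; ring, Real.rpow_natCast]
        norm_cast
  refine hm'.trans (Real.rpow_le_rpow_of_exponent_le (by norm_num) ?_)
  nlinarith

lemma hasLQDC_of_isXorLDC {q : ℕ} {α : ℝ} (hα : 1 / 11 ≤ α)
    (H : ∀ (δ ε : ℝ) (n m : ℕ) (C : Bits n → Bits m), IsXorLDC 4 δ ε C → IsLQDC q δ ε C) :
    HasLQDC q α := by
  intro ε _ hε
  obtain ⟨δ, hδ, c, hc⟩ := exists_isXorLDC_four hε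
  refine ⟨δ, hδ, max c 0, fun n hn => ?_⟩
  obtain ⟨m, C, hC, hm⟩ := hc n hn
  refine ⟨m, C, H _ _ _ _ _ hC, hm.trans (Real.rpow_le_rpow_of_exponent_le (by norm_num) ?_)⟩
  have hn1 : (1 : ℝ) ≤ n := by exact_mod_cast hn
  exact mul_le_mul (le_max_left _ _) (Real.rpow_le_rpow_of_exponent_le hn1 hα) (by positivity)
    (le_max_right _ _)

/-! ### Moments of random signed sums of matrices -/

lemma sum_prod_bitSign_pow {n : ℕ} (T : Fin n → ℕ) :
    ∑ x : Bits n, ∏ i, bitSign ℝ (x i) ^ T i = ∏ i, (1 + (-1) ^ T i) := by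
  have h := Finset.prod_univ_sum (fun _ : Fin n => (Finset.univ : Finset Bool))
    (fun i b => bitSign ℝ b ^ T i)
  rw [Fintype.piFinset_univ] at h
  rw [← h]
  refine Finset.prod_congr rfl fun i _ => ?_
  simp [add_comm]

lemma sum_bitSign_apply {n : ℕ} (i : Fin n) : ∑ x : Bits n, bitSign ℝ (x i) = 0 := by
  have h := sum_prod_bitSign_pow (Pi.single i 1)
  have h1 : ∀ x : Bits n, ∏ j, bitSign ℝ (x j) ^ (Pi.single i 1 : Fin n → ℕ) j =
      bitSign ℝ (x i) := by
    intro x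
    rw [Finset.prod_eq_single i]
    · simp
    · intro j _ hj
      simp [hj]
    · simp
  simp only [h1] at h
  rw [h]
  exact Finset.prod_eq_zero (Finset.mem_univ i) (by simp)

/-- Only the words in which every letter occurs an even number of times survive the average over
the signs, and a word in contractions is a contraction. Hence the averaged power of a signed sum of
contractions is bounded by the moment of the sum of the signs alone. The characters `∏ sᵢ ^ Tᵢ` make
the induction on the exponent possible. -/
lemma norm_sum_signed_pow_le {A : Type*} [NormedRing A] [NormedAlgebra ℝ A] (h1 : ‖(1 : A)‖ ≤ 1)
    {n : ℕ} (M : Fin n → A) (hM : ∀ i, ‖M i‖ ≤ 1) (N : ℕ) (T : Fin n → ℕ) :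
    ‖∑ x : Bits n, (∏ i, bitSign ℝ (x i) ^ T i) • (∑ i, bitSign ℝ (x i) • M i) ^ N‖ ≤
      ∑ x : Bits n, (∏ i, bitSign ℝ (x i) ^ T i) * (∑ i, bitSign ℝ (x i)) ^ N := by
  induction N generalizing T with
  | zero =>
    simp only [pow_zero, mul_one]
    rw [← Finset.sum_smul, norm_smul, Real.norm_eq_abs]
    have h0 : 0 ≤ ∑ x : Bits n, ∏ i, bitSign ℝ (x i) ^ T i := by
      rw [sum_prod_bitSign_pow]
      refine Finset.prod_nonneg fun i _ => ?_
      rcases neg_one_pow_eq_or ℝ (T i) with h | h <;> rw [h] <;> norm_num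
    rw [abs_of_nonneg h0]
    exact mul_le_of_le_one_right h0 h1
  | succ N ih =>
    have hT : ∀ (x : Bits n) (i : Fin n), (∏ j, bitSign ℝ (x j) ^ T j) * bitSign ℝ (x i) =
        ∏ j, bitSign ℝ (x j) ^ (T + Pi.single i 1 : Fin n → ℕ) j := by
      intro x i
      simp only [Pi.add_apply, pow_add, Finset.prod_mul_distrib]
      congr 1
      rw [Finset.prod_eq_single i]
      · simp
      · intro j _ hj
        simp [hj]
      · simp
    have hl : ∑ x : Bits n, (∏ i, bitSign ℝ (x i) ^ T i) •
        (∑ i, bitSign ℝ (x i) • M i) ^ (N + 1) =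
        ∑ i, M i * ∑ x : Bits n, (∏ j, bitSign ℝ (x j) ^ (T + Pi.single i 1 : Fin n → ℕ) j) •
          (∑ i, bitSign ℝ (x i) • M i) ^ N := by
      simp only [pow_succ', Finset.sum_mul, Finset.smul_sum, Finset.mul_sum]
      rw [Finset.sum_comm]
      refine Finset.sum_congr rfl fun i _ => Finset.sum_congr rfl fun x _ => ?_
      rw [← hT, smul_mul_assoc, mul_smul_comm, smul_smul]
    have hr : ∑ x : Bits n, (∏ i, bitSign ℝ (x i) ^ T i) * (∑ i, bitSign ℝ (x i)) ^ (N + 1) =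
        ∑ i, ∑ x : Bits n, (∏ j, bitSign ℝ (x j) ^ (T + Pi.single i 1 : Fin n → ℕ) j) *
          (∑ i, bitSign ℝ (x i)) ^ N := by
      rw [Finset.sum_comm]
      refine Finset.sum_congr rfl fun x _ => ?_
      rw [pow_succ', Finset.sum_mul, Finset.mul_sum]
      refine Finset.sum_congr rfl fun i _ => ?_
      rw [← hT]
      ring
    rw [hl, hr]
    refine (norm_sum_le _ _).trans (Finset.sum_le_sum fun i _ => ?_)
    refine (norm_mul_le _ _).trans ?_
    exact (mul_le_of_le_one_left (norm_nonneg _) (hM i)).trans (ih _)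

/-- The even moments of a sum of `n` random signs, from the moment generating function. -/
lemma sum_sum_bitSign_pow_le (n : ℕ) {N : ℕ} (hN : Even N) {θ : ℝ} (hθ : 0 < θ) :
    ∑ x : Bits n, (∑ i, bitSign ℝ (x i)) ^ N ≤
      2 ^ n * (2 * (N / θ) ^ N * Real.exp (n * (θ ^ 2 / 2))) := by
  have hexp : ∀ t : ℝ, ∑ x : Bits n, Real.exp (t * ∑ i, bitSign ℝ (x i)) ≤
      2 ^ n * Real.exp (n * (t ^ 2 / 2)) := by
    intro t
    have h1 : ∀ x : Bits n, Real.exp (t * ∑ i, bitSign ℝ (x i)) =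
        ∏ i, Real.exp (t * bitSign ℝ (x i)) := by
      intro x
      rw [Finset.mul_sum, Real.exp_sum]
    have h := Finset.prod_univ_sum (fun _ : Fin n => (Finset.univ : Finset Bool))
      (fun _ b => Real.exp (t * bitSign ℝ b))
    rw [Fintype.piFinset_univ] at h
    simp only [h1]
    rw [← h, Finset.prod_const, Finset.card_univ, Fintype.card_fin, Real.exp_nat_mul, ← mul_pow]
    refine pow_le_pow_left₀ (Finset.sum_nonneg fun b _ => (Real.exp_pos _).le) ?_ n
    have h2 := Real.cosh_le_exp_half_sq t
    rw [Real.cosh_eq] at h2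
    simp only [Fintype.sum_bool, bitSign_true, bitSign_false, mul_neg, mul_one]
    linarith
  have hpt : ∀ S : ℝ, S ^ N ≤ (N / θ) ^ N * (Real.exp (θ * S) + Real.exp (-θ * S)) := by
    intro S
    have h1 := Real.pow_div_factorial_le_exp (θ * |S|) (by positivity) N
    have h2 : Real.exp (θ * |S|) ≤ Real.exp (θ * S) + Real.exp (-θ * S) := by
      rcases abs_cases S with ⟨h, -⟩ | ⟨h, -⟩ <;> rw [h]
      · linarith [Real.exp_pos (-θ * S)]
      · rw [show θ * -S = -θ * S by ring]
        linarith [Real.exp_pos (θ * S)]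
    have h3 : (N.factorial : ℝ) ≤ (N : ℝ) ^ N := by exact_mod_cast Nat.factorial_le_pow N
    have hf : (0 : ℝ) < N.factorial := by exact_mod_cast N.factorial_pos
    have h4 : (θ * |S|) ^ N ≤ (N : ℝ) ^ N * (Real.exp (θ * S) + Real.exp (-θ * S)) := by
      rw [div_le_iff₀ hf] at h1
      exact h1.trans ((mul_comm _ _).trans_le
        (mul_le_mul h3 h2 (Real.exp_pos _).le (by positivity)))
    rw [mul_pow, hN.pow_abs] at h4
    rw [div_pow, div_mul_eq_mul_div, le_div_iff₀ (by positivity)]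
    linarith
  calc ∑ x : Bits n, (∑ i, bitSign ℝ (x i)) ^ N
      ≤ ∑ x : Bits n, (N / θ) ^ N * (Real.exp (θ * ∑ i, bitSign ℝ (x i)) +
          Real.exp (-θ * ∑ i, bitSign ℝ (x i))) := Finset.sum_le_sum fun x _ => hpt _
    _ ≤ (N / θ) ^ N * (2 ^ n * Real.exp (n * (θ ^ 2 / 2)) +
          2 ^ n * Real.exp (n * (θ ^ 2 / 2))) := by
        rw [← Finset.mul_sum, Finset.sum_add_distrib]
        have h1 := hexp θ
        have h2 := hexp (-θ)
        rw [neg_sq] at h2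
        gcongr
    _ = _ := by ring

/-! ### Quadratic forms correlated with every bit -/

/-- By the Cauchy-Schwarz inequality the value of the quadratic form of a symmetric matrix is at
most the squared norm of the vector times a Schatten norm of the matrix. -/
lemma quadForm_pow_le {ι : Type} [Fintype ι] [DecidableEq ι] (v : ι → ℝ) (r : ℕ)
    {X : Matrix ι ι ℝ} (hX : X.IsSymm) :
    (v ⬝ᵥ X *ᵥ v) ^ (2 ^ (r + 1)) ≤ (v ⬝ᵥ v) ^ (2 ^ (r + 1)) * (X ^ (2 ^ (r + 1))).trace := by
  have hv : 0 ≤ v ⬝ᵥ v := Finset.sum_nonneg fun i _ => mul_self_nonneg (v i)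
  have cs : ∀ u w : ι → ℝ, (u ⬝ᵥ w) ^ 2 ≤ (u ⬝ᵥ u) * (w ⬝ᵥ w) := by
    intro u w
    simpa [dotProduct, sq] using Finset.sum_mul_sq_le_sq_mul_sq Finset.univ u w
  have hsq : (X *ᵥ v) ⬝ᵥ (X *ᵥ v) = v ⬝ᵥ (X ^ 2) *ᵥ v := by
    rw [sq, ← Matrix.mulVec_mulVec, Matrix.dotProduct_mulVec v, ← Matrix.mulVec_transpose, hX.eq]
  induction r generalizing X with
  | zero =>
    have htr : (X *ᵥ v) ⬝ᵥ (X *ᵥ v) ≤ (v ⬝ᵥ v) * (X ^ 2).trace := by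
      have h1 : (X ^ 2).trace = ∑ i, X i ⬝ᵥ X i := by
        rw [sq, Matrix.trace]
        refine Finset.sum_congr rfl fun i _ => ?_
        rw [Matrix.diag_apply, Matrix.mul_apply]
        exact Finset.sum_congr rfl fun j _ => by rw [hX.apply]
      rw [h1, Finset.mul_sum]
      refine Finset.sum_le_sum fun i _ => ?_
      have := cs (X i) v
      rw [← sq, mul_comm (v ⬝ᵥ v)]
      exact this
    calc (v ⬝ᵥ X *ᵥ v) ^ 2 ≤ (v ⬝ᵥ v) * ((X *ᵥ v) ⬝ᵥ (X *ᵥ v)) := cs _ _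
      _ ≤ (v ⬝ᵥ v) * ((v ⬝ᵥ v) * (X ^ 2).trace) := mul_le_mul_of_nonneg_left htr hv
      _ = (v ⬝ᵥ v) ^ 2 * (X ^ 2).trace := by ring
  | succ r ih =>
    have hX2 : (X ^ 2).IsSymm := hX.pow 2
    have h2 : (v ⬝ᵥ X *ᵥ v) ^ 2 ≤ (v ⬝ᵥ v) * (v ⬝ᵥ (X ^ 2) *ᵥ v) := hsq ▸ cs v (X *ᵥ v)
    have h3 := ih hX2 (by
      rw [sq (X ^ 2), ← Matrix.mulVec_mulVec, Matrix.dotProduct_mulVec v,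
        ← Matrix.mulVec_transpose, hX2.eq])
    rw [pow_succ' 2 (r + 1), pow_mul, pow_mul, pow_mul]
    calc ((v ⬝ᵥ X *ᵥ v) ^ 2) ^ 2 ^ (r + 1)
        ≤ ((v ⬝ᵥ v) * (v ⬝ᵥ (X ^ 2) *ᵥ v)) ^ 2 ^ (r + 1) := pow_le_pow_left₀ (sq_nonneg _) h2 _
      _ = (v ⬝ᵥ v) ^ 2 ^ (r + 1) * (v ⬝ᵥ (X ^ 2) *ᵥ v) ^ 2 ^ (r + 1) := mul_pow _ _ _
      _ ≤ (v ⬝ᵥ v) ^ 2 ^ (r + 1) * ((v ⬝ᵥ v) ^ 2 ^ (r + 1) * ((X ^ 2) ^ 2 ^ (r + 1)).trace) :=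
        mul_le_mul_of_nonneg_left h3 (by positivity)
      _ = _ := by rw [← mul_assoc, ← mul_pow, ← sq]

section

attribute [local instance] Matrix.linftyOpNormedRing Matrix.linftyOpNormedAlgebra

lemma norm_le_of_sum_abs_le {ι : Type} [Fintype ι] [DecidableEq ι] {M : Matrix ι ι ℝ} {c : ℝ}
    (hc : 0 ≤ c) (h : ∀ i, ∑ j, |M i j| ≤ c) : ‖M‖ ≤ c := by
  rw [Matrix.linfty_opNorm_def]
  lift c to NNReal using hc
  rw [NNReal.coe_le_coe]
  refine Finset.sup_le fun i _ => ?_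
  rw [← NNReal.coe_le_coe]
  push_cast
  simpa using h i

lemma sum_abs_le_norm {ι : Type} [Fintype ι] [DecidableEq ι] (M : Matrix ι ι ℝ) (i : ι) :
    ∑ j, |M i j| ≤ ‖M‖ := by
  rw [Matrix.linfty_opNorm_def]
  have h := Finset.le_sup (f := fun i => ∑ j, ‖M i j‖₊) (Finset.mem_univ i)
  rw [← NNReal.coe_le_coe] at h
  push_cast at h
  simpa using h

lemma trace_le_card_mul_norm {ι : Type} [Fintype ι] [DecidableEq ι] (M : Matrix ι ι ℝ) :
    M.trace ≤ Fintype.card ι * ‖M‖ := by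
  rw [Matrix.trace, ← nsmul_eq_mul, ← Finset.card_univ, ← Finset.sum_const]
  refine Finset.sum_le_sum fun i _ => ?_
  refine (le_abs_self _).trans (le_trans ?_ (sum_abs_le_norm M i))
  exact Finset.single_le_sum (f := fun j => |M i j|) (fun j _ => abs_nonneg _) (Finset.mem_univ i)

/-- Quadratic forms `M i` with row sums at most `1` can be correlated with the signs of all `n` bits
on sign vectors `v x` only if their dimension is large. -/
lemma pow_le_of_correlated_forms {ι : Type} [Fintype ι] [DecidableEq ι] {n : ℕ}
    (v : Bits n → ι → ℝ) (hv : ∀ x, v x ⬝ᵥ v x = Fintype.card ι) (M : Fin n → Matrix ι ι ℝ)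
    (hsymm : ∀ i, (M i).IsSymm) (hM : ∀ i j, ∑ k, |M i j k| ≤ 1) {κ : ℝ} (hκ : 0 ≤ κ)
    (hcorr : ∀ i, 2 ^ n * (κ * Fintype.card ι) ≤
      ∑ x, bitSign ℝ (x i) * (v x ⬝ᵥ M i *ᵥ v x)) (hι : 0 < Fintype.card ι) (r : ℕ) {θ : ℝ}
    (hθ : 0 < θ) :
    (n * κ) ^ (2 ^ (r + 1)) ≤ Fintype.card ι *
      (2 * ((2 ^ (r + 1) : ℕ) / θ) ^ (2 ^ (r + 1)) * Real.exp (n * (θ ^ 2 / 2))) := by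
  set N := 2 ^ (r + 1) with hN
  have hNe : Even N := by rw [hN, pow_succ']; exact even_two_mul _
  set D : ℝ := (Fintype.card ι : ℝ) with hD
  have hD0 : 0 < D := Nat.cast_pos.mpr hι
  set X : Bits n → Matrix ι ι ℝ := fun x => ∑ i, bitSign ℝ (x i) • M i with hXdef
  have h2n : (0 : ℝ) < 2 ^ n := by positivity
  have hXsymm : ∀ x, (X x).IsSymm := by
    intro x
    rw [Matrix.IsSymm, hXdef, Matrix.transpose_sum]
    exact Finset.sum_congr rfl fun i _ => by rw [Matrix.transpose_smul, (hsymm i).eq]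
  have hquad : ∀ x, v x ⬝ᵥ X x *ᵥ v x = ∑ i, bitSign ℝ (x i) * (v x ⬝ᵥ M i *ᵥ v x) := by
    intro x
    rw [hXdef, Matrix.sum_mulVec, dotProduct_sum]
    refine Finset.sum_congr rfl fun i _ => ?_
    rw [Matrix.smul_mulVec, dotProduct_smul, smul_eq_mul]
  have hlow : n * κ * D ≤ ∑ x, (1 / 2 ^ n : ℝ) * (v x ⬝ᵥ X x *ᵥ v x) := by
    simp only [hquad]
    rw [← Finset.mul_sum, Finset.sum_comm]
    have h1 : ∑ _i : Fin n, 2 ^ n * (κ * D) ≤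
        ∑ i, ∑ x, bitSign ℝ (x i) * (v x ⬝ᵥ M i *ᵥ v x) :=
      Finset.sum_le_sum fun i _ => hcorr i
    rw [Finset.sum_const, Finset.card_univ, Fintype.card_fin, nsmul_eq_mul] at h1
    rw [one_div_mul_eq_div, le_div_iff₀ h2n]
    linarith
  have hjensen : (∑ x, (1 / 2 ^ n : ℝ) * (v x ⬝ᵥ X x *ᵥ v x)) ^ N ≤
      ∑ x, (1 / 2 ^ n : ℝ) * (v x ⬝ᵥ X x *ᵥ v x) ^ N := by
    apply Real.pow_arith_mean_le_arith_mean_pow_of_even _ _ _ _ _ hNe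
    · intro x _
      positivity
    · simp [Bits]
  have hup : ∑ x, (v x ⬝ᵥ X x *ᵥ v x) ^ N ≤ D ^ N * (D * ∑ x : Bits n,
      (∑ i, bitSign ℝ (x i)) ^ N) := by
    have h1 : ∑ x, (v x ⬝ᵥ X x *ᵥ v x) ^ N ≤ ∑ x, D ^ N * (X x ^ N).trace := by
      refine Finset.sum_le_sum fun x _ => ?_
      rw [← hv x]
      exact quadForm_pow_le (v x) r (hXsymm x)
    refine h1.trans ?_
    rw [← Finset.mul_sum, ← Matrix.trace_sum]
    refine mul_le_mul_of_nonneg_left ?_ (by positivity)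
    refine (trace_le_card_mul_norm _).trans (mul_le_mul_of_nonneg_left ?_ hD0.le)
    have hone : ‖(1 : Matrix ι ι ℝ)‖ ≤ 1 := norm_le_of_sum_abs_le zero_le_one fun i => by
      rw [Finset.sum_eq_single i] <;> simp +contextual [eq_comm]
    have h2 := norm_sum_signed_pow_le hone M
      (fun i => norm_le_of_sum_abs_le zero_le_one (hM i)) N 0
    simpa using h2
  have hpow : (n * κ * D) ^ N ≤ D ^ N * (D * (2 * (N / θ) ^ N * Real.exp (n * (θ ^ 2 / 2)))) := by
    calc (n * κ * D) ^ N ≤ (∑ x, (1 / 2 ^ n : ℝ) * (v x ⬝ᵥ X x *ᵥ v x)) ^ N :=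
        pow_le_pow_left₀ (by positivity) hlow N
      _ ≤ (1 / 2 ^ n : ℝ) * ∑ x, (v x ⬝ᵥ X x *ᵥ v x) ^ N := by
        rw [Finset.mul_sum]
        exact hjensen
      _ ≤ (1 / 2 ^ n : ℝ) * (D ^ N * (D * (2 ^ n *
          (2 * (N / θ) ^ N * Real.exp (n * (θ ^ 2 / 2)))))) := by
        refine mul_le_mul_of_nonneg_left (hup.trans ?_) (by positivity)
        have := sum_sum_bitSign_pow_le n hNe hθ
        gcongr
      _ = _ := by field_simp
  rw [mul_pow, mul_comm] at hpow
  exact le_of_mul_le_mul_left hpow (by positivity)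

end

/-! ### From two-query decoders to quadratic forms -/

/-- The signs of the bits of `y`, followed by equally many ones: linear terms in the signs become
quadratic terms in the entries of this vector, without a row that serves all positions at once. -/
def signVector {m : ℕ} (y : Bits m) (k : Fin m × Bool) : ℝ := if k.2 then 1 else bitSign ℝ (y k.1)

lemma signVector_dotProduct_self {m : ℕ} (y : Bits m) :
    signVector y ⬝ᵥ signVector y = Fintype.card (Fin m × Bool) := by
  have h1 : ∀ k, signVector y k * signVector y k = 1 := by
    rintro ⟨j, b⟩
    cases b <;> simp [signVector, bitSign_mul_self]
  simp only [dotProduct, h1]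
  simp

/-- The symmetric matrix of the quadratic form `u ↦ u p * u q`. -/
noncomputable def pairForm {ι : Type} [DecidableEq ι] (p q : ι) : Matrix ι ι ℝ :=
  (1 / 2 : ℝ) • (Matrix.single p q 1 + Matrix.single q p 1)

lemma pairForm_isSymm {ι : Type} [DecidableEq ι] (p q : ι) : (pairForm p q).IsSymm := by
  rw [Matrix.IsSymm, pairForm, Matrix.transpose_smul, Matrix.transpose_add, Matrix.transpose_single,
    Matrix.transpose_single, add_comm]

lemma dotProduct_pairForm {ι : Type} [Fintype ι] [DecidableEq ι] (p q : ι) (u : ι → ℝ) :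
    u ⬝ᵥ pairForm p q *ᵥ u = u p * u q := by
  have h1 : ∀ p q : ι, u ⬝ᵥ Matrix.single p q (1 : ℝ) *ᵥ u = u p * u q := by
    intro p q
    have h2 : Matrix.single p q (1 : ℝ) *ᵥ u = Pi.single p (u q) := by
      rw [Matrix.single_mulVec, one_mul]
      rfl
    rw [h2, dotProduct_single]
  rw [pairForm, Matrix.smul_mulVec, Matrix.add_mulVec, dotProduct_smul, dotProduct_add, h1, h1,
    smul_eq_mul]
  ring

lemma sum_abs_pairForm_le {ι : Type} [Fintype ι] [DecidableEq ι] (p q r : ι) :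
    ∑ k, |pairForm p q r k| ≤ if r = p ∨ r = q then 1 else 0 := by
  have h1 : ∀ p q : ι, ∑ k, |Matrix.single p q (1 : ℝ) r k| = if r = p then 1 else 0 := by
    intro p q
    rw [Finset.sum_eq_single q]
    · by_cases h : r = p
      · simp [h]
      · simp [h, Ne.symm h]
    · intro k _ hk
      simp [Ne.symm hk]
    · simp
  calc ∑ k, |pairForm p q r k|
      ≤ ∑ k, (1 / 2 : ℝ) * (|Matrix.single p q (1 : ℝ) r k| + |Matrix.single q p (1 : ℝ) r k|) := by
        refine Finset.sum_le_sum fun k _ => ?_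
        rw [pairForm, Matrix.smul_apply, Matrix.add_apply, smul_eq_mul, abs_mul,
          abs_of_pos (by norm_num : (0 : ℝ) < 1 / 2)]
        exact mul_le_mul_of_nonneg_left (abs_add_le _ _) (by norm_num)
    _ = (1 / 2 : ℝ) * ((if r = p then 1 else 0) + if r = q then 1 else 0) := by
        rw [← Finset.mul_sum, Finset.sum_add_distrib, h1, h1]
    _ ≤ _ := by
        by_cases hp : r = p
        · rw [if_pos hp, if_pos (Or.inl hp)]
          split_ifs <;> norm_num
        · by_cases hq : r = q
          · rw [if_neg hp, if_pos hq, if_pos (Or.inr hq)]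
            norm_num
          · simp [hp, hq]

/-- A bounded function of at most two bits is a constant plus a quadratic form in the sign vector,
by its Fourier expansion. -/
lemma exists_form_of_dependsOn {m : ℕ} (g : Bits m → ℝ) (L : Finset (Fin m)) (hL : L.card ≤ 2)
    (hg : DependsOn g (L : Set (Fin m))) (hg1 : ∀ y, |g y| ≤ 1) :
    ∃ (a : ℝ) (B : Matrix (Fin m × Bool) (Fin m × Bool) ℝ), B.IsSymm ∧
      (∀ y, g y = a + signVector y ⬝ᵥ B *ᵥ signVector y) ∧
      ∀ r, ∑ k, |B r k| ≤ if r.1 ∈ L then 3 else 0 := by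
  obtain h0 | h1 | h2 : L.card = 0 ∨ L.card = 1 ∨ L.card = 2 := by omega
  · rw [Finset.card_eq_zero] at h0
    subst h0
    refine ⟨g fun _ => false, 0, Matrix.isSymm_zero, fun y => ?_, fun r => by simp⟩
    rw [Matrix.zero_mulVec, dotProduct_zero, add_zero]
    exact hg fun i hi => absurd hi (by simp)
  · obtain ⟨j, rfl⟩ := Finset.card_eq_one.mp h1
    set G : Bool → ℝ := fun b => g fun _ => b with hG
    have hGy : ∀ y, g y = G (y j) := fun y => hg fun i hi => by
      rw [Finset.coe_singleton, Set.mem_singleton_iff] at hi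
      rw [hi]
    have hG1 : ∀ b, |G b| ≤ 1 := fun b => hg1 _
    refine ⟨(G false + G true) / 2, ((G false - G true) / 2) • pairForm (j, false) (j, true),
      (pairForm_isSymm _ _).smul _, fun y => ?_, fun r => ?_⟩
    · rw [Matrix.smul_mulVec, dotProduct_smul, dotProduct_pairForm, hGy, smul_eq_mul]
      cases h : y j <;> simp [signVector, h] <;> ring
    · have hc : |(G false - G true) / 2| ≤ 1 := by
        have h2 := abs_le.mp (hG1 false)
        have h3 := abs_le.mp (hG1 true)
        rw [abs_le]
        constructor <;> linarith
      simp only [Matrix.smul_apply, smul_eq_mul, abs_mul]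
      rw [← Finset.mul_sum]
      refine (mul_le_of_le_one_left (Finset.sum_nonneg fun _ _ => abs_nonneg _) hc).trans
        ((sum_abs_pairForm_le _ _ _).trans ?_)
      by_cases hr : r.1 = j
      · simp only [hr, Finset.mem_singleton, if_true]
        split_ifs <;> norm_num
      · have h4 : ¬ (r = (j, false) ∨ r = (j, true)) := by
          rintro (h | h) <;> exact hr (by rw [h])
        simp [h4, hr]
  · obtain ⟨j, l, hjl, rfl⟩ := Finset.card_eq_two.mp h2
    set G : Bool → Bool → ℝ := fun b b' => g fun i => if i = j then b else b' with hG
    have hGy : ∀ y, g y = G (y j) (y l) := fun y => hg fun i hi => by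
      rw [Finset.mem_coe, Finset.mem_insert, Finset.mem_singleton] at hi
      rcases hi with rfl | rfl
      · simp
      · simp [hjl.symm]
    have hG1 : ∀ b b', |G b b'| ≤ 1 := fun b b' => hg1 _
    set c1 := (G false false + G false true - G true false - G true true) / 4 with hc1
    set c2 := (G false false - G false true + G true false - G true true) / 4 with hc2
    set c3 := (G false false - G false true - G true false + G true true) / 4 with hc3
    have hcs : |c1| ≤ 1 ∧ |c2| ≤ 1 ∧ |c3| ≤ 1 := by
      have e1 := abs_le.mp (hG1 false false)
      have e2 := abs_le.mp (hG1 false true)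
      have e3 := abs_le.mp (hG1 true false)
      have e4 := abs_le.mp (hG1 true true)
      refine ⟨?_, ?_, ?_⟩ <;> rw [abs_le] <;> constructor <;> linarith
    refine ⟨(G false false + G false true + G true false + G true true) / 4,
      c1 • pairForm (j, false) (j, true) + c2 • pairForm (l, false) (l, true) +
        c3 • pairForm (j, false) (l, false), ?_, fun y => ?_, fun r => ?_⟩
    · exact (((pairForm_isSymm _ _).smul _).add ((pairForm_isSymm _ _).smul _)).add
        ((pairForm_isSymm _ _).smul _)
    · simp only [Matrix.add_mulVec, Matrix.smul_mulVec, dotProduct_add, dotProduct_smul,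
        dotProduct_pairForm, smul_eq_mul, hGy]
      cases h : y j <;> cases h' : y l <;> simp [signVector, h, h', hc1, hc2, hc3] <;> ring
    · have hb : ∀ (c : ℝ) (p q : Fin m × Bool), |c| ≤ 1 →
          (p.1 ∈ ({j, l} : Finset (Fin m)) ∧ q.1 ∈ ({j, l} : Finset (Fin m))) →
          ∑ k, |(c • pairForm p q) r k| ≤ if r.1 ∈ ({j, l} : Finset (Fin m)) then 1 else 0 := by
        intro c p q hc ⟨hp, hq⟩
        simp only [Matrix.smul_apply, smul_eq_mul, abs_mul]
        rw [← Finset.mul_sum]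
        refine (mul_le_of_le_one_left (Finset.sum_nonneg fun _ _ => abs_nonneg _) hc).trans
          ((sum_abs_pairForm_le _ _ _).trans ?_)
        by_cases hr : r.1 ∈ ({j, l} : Finset (Fin m))
        · rw [if_pos hr]
          split_ifs <;> norm_num
        · have h4 : ¬ (r = p ∨ r = q) := by
            rintro (h | h)
            · exact hr (h ▸ hp)
            · exact hr (h ▸ hq)
          rw [if_neg hr, if_neg h4]
      have b1 := hb c1 (j, false) (j, true) hcs.1 (by simp)
      have b2 := hb c2 (l, false) (l, true) hcs.2.1 (by simp)
      have b3 := hb c3 (j, false) (l, false) hcs.2.2 (by simp)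
      calc _ ≤ ∑ k, (|(c1 • pairForm (j, false) (j, true)) r k| +
            |(c2 • pairForm (l, false) (l, true)) r k| +
            |(c3 • pairForm (j, false) (l, false)) r k|) := by
            refine Finset.sum_le_sum fun k _ => ?_
            rw [Matrix.add_apply, Matrix.add_apply]
            exact abs_add_three _ _ _
        _ ≤ _ := by
            rw [Finset.sum_add_distrib, Finset.sum_add_distrib]
            split_ifs at b1 b2 b3 ⊢ <;> linarith

lemma sum_signed_prob {Ω : Type} [Fintype Ω] (p : PMF Ω) (f : Ω → Bool) (b : Bool) :
    ∑ ω, (p ω).toReal * (bitSign ℝ b * bitSign ℝ (f ω)) = 2 * prob p {ω | f ω = b} - 1 := by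
  rw [prob_setOf_eq_sum, ← sum_toReal_eq_one p, Finset.mul_sum, ← Finset.sum_sub_distrib]
  refine Finset.sum_congr rfl fun ω _ => ?_
  cases b <;> cases f ω <;> simp <;> ring

/-- A decoder still works if the few positions that it queries with high probability are erased;
then all other positions are queried with low probability, which bounds the row sums of the average
of the forms that describe its output. -/
lemma IsLDC.exists_form {n m : ℕ} {δ ε : ℝ} {C : Bits n → Bits m} (h : IsLDC 2 δ ε C) (hδ : 0 < δ)
    (hm : 0 < m) (i : Fin n) :
    ∃ (a : ℝ) (M : Matrix (Fin m × Bool) (Fin m × Bool) ℝ), M.IsSymm ∧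
      (∀ r, ∑ k, |M r k| ≤ 6 / (δ * m)) ∧
      ∀ x, 2 * ε ≤ bitSign ℝ (x i) * (a + signVector (C x) ⬝ᵥ M *ᵥ signVector (C x)) := by
  classical
  obtain ⟨A, hA, hdec⟩ := h i
  have hm' : (0 : ℝ) < m := by exact_mod_cast hm
  have hδm : 0 < δ * m := mul_pos hδ hm'
  set P : Fin m → ℝ := fun j => ∑ ω, if j ∈ ω.1 then (A ω).toReal else 0 with hP
  have hP0 : ∀ j, 0 ≤ P j := fun j =>
    Finset.sum_nonneg fun ω _ => by split_ifs <;> positivity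
  have hPsum : ∑ j, P j ≤ 2 := by
    rw [hP, Finset.sum_comm]
    calc ∑ ω : Finset (Fin m) × (Bits m → Bool), ∑ j, (if j ∈ ω.1 then (A ω).toReal else 0)
        ≤ ∑ ω, 2 * (A ω).toReal := by
          refine Finset.sum_le_sum fun ω _ => ?_
          rw [← Finset.sum_filter, Finset.sum_const, nsmul_eq_mul, Finset.filter_univ_mem]
          by_cases hω : ω ∈ A.support
          · have := (hA ω hω).1
            have h2 : (ω.1.card : ℝ) ≤ 2 := by exact_mod_cast this
            exact mul_le_mul_of_nonneg_right h2 ENNReal.toReal_nonneg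
          · rw [PMF.mem_support_iff, not_not] at hω
            simp [hω]
      _ = 2 := by rw [← Finset.mul_sum, sum_toReal_eq_one, mul_one]
  -- the positions that are queried with high probability
  set H : Finset (Fin m) := Finset.univ.filter fun j => 2 / (δ * m) < P j with hH
  have hHcard : (H.card : ℝ) ≤ δ * m := by
    have h1 : H.card * (2 / (δ * m)) ≤ 2 := by
      calc H.card * (2 / (δ * m)) = ∑ j ∈ H, 2 / (δ * m) := by
            rw [Finset.sum_const, nsmul_eq_mul]
        _ ≤ ∑ j ∈ H, P j := Finset.sum_le_sum fun j hj => (Finset.mem_filter.mp hj).2.le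
        _ ≤ ∑ j, P j := Finset.sum_le_sum_of_subset_of_nonneg (Finset.subset_univ _)
            fun j _ _ => hP0 j
        _ ≤ 2 := hPsum
    rw [mul_div_assoc', div_le_iff₀ hδm] at h1
    linarith
  set erase : Bits m → Bits m := fun y j => if j ∈ H then false else y j with herase
  have hdist : ∀ y, (hammingDist y (erase y) : ℝ) ≤ δ * m := by
    intro y
    refine le_trans ?_ hHcard
    norm_cast
    refine Finset.card_le_card fun j hj => ?_
    by_contra hjH
    simp [herase, hjH] at hj
  have hform : ∀ ω : Finset (Fin m) × (Bits m → Bool), ∃ aB : ℝ ×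
      Matrix (Fin m × Bool) (Fin m × Bool) ℝ, ω ∈ A.support → aB.2.IsSymm ∧
      (∀ y, bitSign ℝ (ω.2 (erase y)) = aB.1 + signVector y ⬝ᵥ aB.2 *ᵥ signVector y) ∧
      ∀ r, ∑ k, |aB.2 r k| ≤ if r.1 ∈ ω.1 \ H then 3 else 0 := by
    intro ω
    by_cases hω : ω ∈ A.support
    · obtain ⟨a, B, hB⟩ := exists_form_of_dependsOn (fun y => bitSign ℝ (ω.2 (erase y))) (ω.1 \ H)
        ((Finset.card_le_card Finset.sdiff_subset).trans (hA ω hω).1)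
        (by
          intro y y' hy
          simp only
          rw [(hA ω hω).2]
          intro j hj
          by_cases hjH : j ∈ H
          · simp [herase, hjH]
          · simp only [herase, hjH, if_false]
            exact hy j (by simpa [hjH] using hj))
        (fun y => by cases ω.2 (erase y) <;> simp)
      exact ⟨(a, B), fun _ => hB⟩
    · exact ⟨0, fun h => absurd h hω⟩
  choose F hF using hform
  have hzero : ∀ ω, ω ∉ A.support → (A ω).toReal = 0 := by
    intro ω hω
    rw [PMF.mem_support_iff, not_not] at hω
    simp [hω]
  refine ⟨∑ ω, (A ω).toReal * (F ω).1, ∑ ω, (A ω).toReal • (F ω).2, ?_, fun r => ?_, fun x => ?_⟩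
  · rw [Matrix.IsSymm, Matrix.transpose_sum]
    refine Finset.sum_congr rfl fun ω _ => ?_
    by_cases hω : ω ∈ A.support
    · rw [Matrix.transpose_smul, (hF ω hω).1.eq]
    · rw [hzero ω hω, zero_smul, Matrix.transpose_zero]
  · calc ∑ k, |(∑ ω, (A ω).toReal • (F ω).2) r k|
        ≤ ∑ k, ∑ ω, (A ω).toReal * |(F ω).2 r k| := by
          refine Finset.sum_le_sum fun k _ => ?_
          rw [Matrix.sum_apply]
          refine (Finset.abs_sum_le_sum_abs _ _).trans (le_of_eq ?_)
          refine Finset.sum_congr rfl fun ω _ => ?_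
          rw [Matrix.smul_apply, smul_eq_mul, abs_mul, abs_of_nonneg ENNReal.toReal_nonneg]
      _ = ∑ ω, (A ω).toReal * ∑ k, |(F ω).2 r k| := by
          rw [Finset.sum_comm]
          exact Finset.sum_congr rfl fun ω _ => (Finset.mul_sum _ _ _).symm
      _ ≤ ∑ ω, (A ω).toReal * (if r.1 ∈ ω.1 \ H then 3 else 0) := by
          refine Finset.sum_le_sum fun ω _ => ?_
          by_cases hω : ω ∈ A.support
          · exact mul_le_mul_of_nonneg_left ((hF ω hω).2.2 r) ENNReal.toReal_nonneg
          · rw [hzero ω hω, zero_mul, zero_mul]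
      _ ≤ 6 / (δ * m) := by
          by_cases hr : r.1 ∈ H
          · simp only [Finset.mem_sdiff, hr, not_true, and_false, if_false, mul_zero,
              Finset.sum_const_zero]
            positivity
          · have h1 : ∑ ω : Finset (Fin m) × (Bits m → Bool),
                (A ω).toReal * (if r.1 ∈ ω.1 \ H then 3 else 0) = 3 * P r.1 := by
              rw [hP, Finset.mul_sum]
              refine Finset.sum_congr rfl fun ω _ => ?_
              simp only [Finset.mem_sdiff, hr, not_false_iff, and_true]
              split_ifs <;> ring
            have h2 : P r.1 ≤ 2 / (δ * m) := by
              by_contra hlt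
              exact hr (Finset.mem_filter.mpr ⟨Finset.mem_univ _, not_le.mp hlt⟩)
            rw [h1, show 6 / (δ * m) = 3 * (2 / (δ * m)) by ring]
            linarith
  · have h1 := hdec x (erase (C x)) (hdist _)
    have h2 := sum_signed_prob A (fun ω => ω.2 (erase (C x))) (x i)
    have h3 : ∑ ω, (A ω).toReal * (F ω).1 +
        signVector (C x) ⬝ᵥ (∑ ω, (A ω).toReal • (F ω).2) *ᵥ signVector (C x) =
        ∑ ω, (A ω).toReal * bitSign ℝ (ω.2 (erase (C x))) := by
      rw [Matrix.sum_mulVec, dotProduct_sum, ← Finset.sum_add_distrib]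
      refine Finset.sum_congr rfl fun ω _ => ?_
      rw [Matrix.smul_mulVec, dotProduct_smul, smul_eq_mul, ← mul_add]
      by_cases hω : ω ∈ A.support
      · rw [(hF ω hω).2.1]
      · rw [hzero ω hω, zero_mul, zero_mul]
    rw [h3, Finset.mul_sum]
    have h4 : ∀ ω : Finset (Fin m) × (Bits m → Bool),
        bitSign ℝ (x i) * ((A ω).toReal * bitSign ℝ (ω.2 (erase (C x)))) =
        (A ω).toReal * (bitSign ℝ (x i) * bitSign ℝ (ω.2 (erase (C x)))) := fun ω => by ring
    simp only [h4]
    rw [h2]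
    linarith

lemma IsLDC.length_pos {n m q : ℕ} {δ ε : ℝ} {C : Bits n → Bits m} (h : IsLDC q δ ε C)
    (hε : 0 < ε) (hn : 1 ≤ n) : 0 < m := by
  by_contra hm
  obtain rfl : m = 0 := by omega
  obtain ⟨A, -, hA⟩ := h ⟨0, hn⟩
  set y : Bits 0 := Fin.elim0
  have hd : ∀ x, (hammingDist (C x) y : ℝ) ≤ δ * (0 : ℕ) := by
    intro x
    simp [Subsingleton.elim (C x) y]
  have h0 := hA (fun _ => false) y (hd _)
  have h1 := hA (fun _ => true) y (hd _)
  have h2 := sum_signed_prob A (fun ω => ω.2 y) false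
  have h3 := sum_signed_prob A (fun ω => ω.2 y) true
  have h4 : ∑ ω, (A ω).toReal * (bitSign ℝ true * bitSign ℝ (ω.2 y)) =
      -∑ ω, (A ω).toReal * (bitSign ℝ false * bitSign ℝ (ω.2 y)) := by
    rw [← Finset.sum_neg_distrib]
    exact Finset.sum_congr rfl fun ω _ => by simp
  linarith

/-- The moment bound for a code with `n` bits and length `m`, for an arbitrary power of two. -/
lemma IsLDC.pow_le {n m : ℕ} {δ ε : ℝ} {C : Bits n → Bits m} (h : IsLDC 2 δ ε C) (hδ : 0 < δ)
    (hε : 0 < ε) (hm : 0 < m) (r : ℕ) {θ : ℝ} (hθ : 0 < θ) :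
    (n * (ε * δ / 6)) ^ (2 ^ (r + 1)) ≤ (2 * m) *
      (2 * ((2 ^ (r + 1) : ℕ) / θ) ^ (2 ^ (r + 1)) * Real.exp (n * (θ ^ 2 / 2))) := by
  have hm' : (0 : ℝ) < m := by exact_mod_cast hm
  choose a M hsymm hM hcorr using h.exists_form hδ hm
  have hs : 0 < δ * m / 6 := by positivity
  have hcard : (Fintype.card (Fin m × Bool) : ℝ) = 2 * m := by
    simp [mul_comm]
  have key := pow_le_of_correlated_forms (fun x => signVector (C x))
    (fun x => signVector_dotProduct_self (C x)) (fun i => (δ * m / 6) • M i)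
    (fun i => (hsymm i).smul _) (fun i j => ?_) (κ := ε * δ / 6) (by positivity) (fun i => ?_)
    (by simp [hm]) r hθ
  · rwa [hcard] at key
  · simp only [Matrix.smul_apply, smul_eq_mul, abs_mul, abs_of_pos hs]
    rw [← Finset.mul_sum]
    calc δ * m / 6 * ∑ k, |M i j k| ≤ δ * m / 6 * (6 / (δ * m)) :=
          mul_le_mul_of_nonneg_left (hM i j) hs.le
      _ = 1 := by field_simp
  · have h1 : ∑ _x : Bits n, 2 * ε ≤ ∑ x : Bits n,
        bitSign ℝ (x i) * (a i + signVector (C x) ⬝ᵥ M i *ᵥ signVector (C x)) :=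
      Finset.sum_le_sum fun x _ => hcorr i x
    simp only [mul_add, Finset.sum_add_distrib] at h1
    have h0 : ∑ x : Bits n, bitSign ℝ (x i) * a i = 0 := by
      rw [← Finset.sum_mul, sum_bitSign_apply, zero_mul]
    rw [h0, zero_add, Finset.sum_const, Finset.card_univ, nsmul_eq_mul] at h1
    simp only [Bits, Fintype.card_fun, Fintype.card_bool, Fintype.card_fin, Nat.cast_pow,
      Nat.cast_ofNat] at h1
    simp only [Matrix.smul_mulVec, dotProduct_smul, smul_eq_mul]
    have h2 : ∀ x : Bits n, bitSign ℝ (x i) * (δ * m / 6 *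
        (signVector (C x) ⬝ᵥ M i *ᵥ signVector (C x))) = δ * m / 6 *
        (bitSign ℝ (x i) * (signVector (C x) ⬝ᵥ M i *ᵥ signVector (C x))) := fun x => by ring
    simp only [h2]
    rw [← Finset.mul_sum, hcard]
    have h3 := mul_le_mul_of_nonneg_left h1 hs.le
    refine le_trans (le_of_eq ?_) h3
    ring

/-- The exponent of the moment is the power of two between `θ² n / 2` and `θ² n`, where
`θ = κ / e²` and `κ = ε δ / 6` is the correlation with every bit. -/
theorem IsLDC.two_query_lower_bound {δ ε : ℝ} (hδ : 0 < δ) (hε : 0 < ε) :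
    ∃ c : ℝ, 0 < c ∧ ∀ (n m : ℕ) (C : Bits n → Bits m), 1 ≤ n → IsLDC 2 δ ε C →
      (2 : ℝ) ^ (c * n - 1) ≤ m := by
  set κ := ε * δ / 6 with hκ
  have hκ0 : 0 < κ := by positivity
  set θ := κ / Real.exp 2 with hθ
  have hθ0 : 0 < θ := by positivity
  refine ⟨θ ^ 2 / 5, by positivity, fun n m C hn h => ?_⟩
  have hm := h.length_pos hε hn
  have hm1 : (1 : ℝ) ≤ m := by exact_mod_cast hm
  set y := θ ^ 2 * n with hy
  by_cases hy2 : y < 2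
  · refine le_trans ?_ hm1
    apply Real.rpow_le_one_of_one_le_of_nonpos (by norm_num)
    rw [show θ ^ 2 / 5 * n = y / 5 by rw [hy]; ring]
    linarith
  · push Not at hy2
    obtain ⟨r, hr1, hr2⟩ : ∃ r : ℕ, (2 : ℝ) ^ (r + 1) ≤ y ∧ y < 2 ^ (r + 2) := by
      obtain ⟨k, hk1, hk2⟩ := exists_nat_pow_near (x := y) (y := 2) (by linarith) (by norm_num)
      obtain ⟨r, rfl⟩ : ∃ r, k = r + 1 := by
        cases k with
        | zero => norm_num at hk2; linarith
        | succ r => exact ⟨r, rfl⟩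
      exact ⟨r, hk1, hk2⟩
    have key := h.pow_le hδ hε hm r hθ0
    set N := 2 ^ (r + 1) with hN
    have hNc : (N : ℝ) = 2 ^ (r + 1) := by rw [hN]; push_cast; rfl
    rw [← hNc] at hr1
    have hr2' : y < 2 * N := by
      rw [hNc]
      calc y < 2 ^ (r + 2) := hr2
        _ = 2 * 2 ^ (r + 1) := by ring
    have hN0 : (0 : ℝ) < N := by rw [hNc]; positivity
    have hn0 : (0 : ℝ) < n := by exact_mod_cast hn
    -- `n κ θ / N ≥ e²` since `N ≤ θ² n = n κ θ / e²`
    have h1 : (Real.exp 2 * (N / θ)) ^ N ≤ (n * κ) ^ N := by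
      apply pow_le_pow_left₀ (by positivity)
      have h2 : y / θ = θ * n := by rw [hy]; field_simp
      have h3 : N / θ ≤ θ * n := h2 ▸ div_le_div_of_nonneg_right hr1 hθ0.le
      calc Real.exp 2 * (N / θ) ≤ Real.exp 2 * (θ * n) :=
            mul_le_mul_of_nonneg_left h3 (Real.exp_pos 2).le
        _ = n * κ := by rw [hθ]; field_simp
    have h4 : Real.exp (2 * N) ≤ 4 * m * Real.exp (y / 2) := by
      have h5 := h1.trans key
      rw [mul_pow, ← Real.exp_nat_mul] at h5
      have h6 : 0 < ((N : ℝ) / θ) ^ N := by positivity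
      have h7 : (n : ℝ) * (θ ^ 2 / 2) = y / 2 := by rw [hy]; ring
      rw [h7] at h5
      refine le_of_mul_le_mul_right ?_ h6
      calc Real.exp (2 * N) * ((N : ℝ) / θ) ^ N = Real.exp (N * 2) * ((N : ℝ) / θ) ^ N := by
            rw [mul_comm (2 : ℝ)]
        _ ≤ _ := h5
        _ = _ := by ring
    have h8 : Real.exp (y / 2) ≤ 4 * m := by
      have h9 : Real.exp y ≤ 4 * m * Real.exp (y / 2) :=
        (Real.exp_le_exp.mpr hr2'.le).trans h4
      have h10 : Real.exp y = Real.exp (y / 2) * Real.exp (y / 2) := by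
        rw [← Real.exp_add]
        ring_nf
      rw [h10] at h9
      exact le_of_mul_le_mul_right h9 (Real.exp_pos _)
    have h11 : (2 : ℝ) ^ (θ ^ 2 / 5 * n - 1) = (2 : ℝ) ^ (y / 5 + 1) / 4 := by
      rw [show θ ^ 2 / 5 * n - 1 = (y / 5 + 1) - 2 by rw [hy]; ring, Real.rpow_sub (by norm_num)]
      norm_num
    have h12 : (2 : ℝ) ^ (y / 5 + 1) ≤ Real.exp (y / 2) := by
      rw [Real.rpow_def_of_pos (by norm_num)]
      apply Real.exp_le_exp.mpr
      have := Real.log_two_lt_d9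
      nlinarith
    rw [h11]
    linarith

theorem mainTheorem7 :
    -- a classical XOR scheme with `2k` servers gives a quantum scheme with `k` servers
    (∀ (k n t : ℕ) (ε : ℝ) (S : ClassicalPIR (2 * k) n t 1 ε), S.IsXor →
      Nonempty (QuantumPIR k n (t + 1) (t + 1) ε)) ∧
    -- an XOR code with `2q` classical queries is decodable with `q` quantum queries
    (∀ (q n m : ℕ) (δ ε : ℝ) (C : Bits n → Bits m), IsXorLDC (2 * q) δ ε C →
      IsLQDC q δ ε C) ∧
    -- quantum private information retrieval with 2, 3 and 4 servers
    HasQuantumPIR 2 (3 / 10) ∧ HasQuantumPIR 3 (1 / 7) ∧ HasQuantumPIR 4 (1 / 11) ∧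
    -- locally quantum-decodable codes with 2, 3 and 4 queries
    HasLQDC 2 (3 / 10) ∧ HasLQDC 3 (1 / 7) ∧ HasLQDC 4 (1 / 11) ∧
    -- the classical bounds for comparison: 2-server schemes
    HasClassicalPIR 2 (1 / 3) ∧
    -- 2-query locally decodable codes have length at least `2 ^ Ω(n)`
    (∀ δ ε : ℝ, 0 < δ → 0 < ε → ∃ c : ℝ, 0 < c ∧
      ∀ (n m : ℕ) (C : Bits n → Bits m), 1 ≤ n → IsLDC 2 δ ε C →
        (2 : ℝ) ^ (c * n - 1) ≤ m) ∧
    -- and length `2 ^ n` suffices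
    (∀ (n : ℕ) (δ : ℝ), 0 ≤ δ →
      ∃ C : Bits n → Bits (2 ^ n), IsLDC 2 δ (1 / 2 - 2 * δ) C) := by
  refine ⟨fun k n t ε S hS => quantumPIR_of_xor S hS, fun q n m δ ε C h => isLQDC_of_isXorLDC h,
    (hasClassicalPIR_two.mono (by norm_num)).toQuantum,
    ((hasClassicalPIR_two.addServer (by norm_num)).mono (by norm_num)).toQuantum,
    ((hasClassicalPIR_two.addServer (by norm_num)).addServer (by norm_num)).toQuantum,
    hasLQDC_of_isXorLDC (by norm_num) fun δ ε n m C h => isLQDC_of_isXorLDC (q := 2) h,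
    hasLQDC_of_isXorLDC (by norm_num) fun δ ε n m C h => isLQDC_of_isXorLDC (q := 3) h.add_two,
    hasLQDC_of_isXorLDC (by norm_num) fun δ ε n m C h =>
      isLQDC_of_isXorLDC (q := 4) h.add_two.add_two,
    hasClassicalPIR_two.mono (by norm_num),
    fun δ ε hδ hε => IsLDC.two_query_lower_bound hδ hε,
    fun n δ _ => exists_hadamardCode n δ⟩
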